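/- Let $k>0$ be a real number (in particular, $k$ may be any positive integer), and let $\mathcal T^{(k)}$ be the self-similar Poisson point process on $(0,\infty)$ with intensity function $k/t$, regarded as a random set of points. Let $\mathcal S^{(k)}$ be the random set of spacings of $\mathcal T^{(k)}$, i.e. the set of all differences $t-s$ where $s<t$ are consecutive points of $\mathcal T^{(k)}$, meaning $[s,t]\cap\mathcal T^{(k)}=\{s,t\}$. Then, almost surely, distinct pairs of consecutive points have distinct spacings (so $\mathcal S^{(k)}$, counted with multiplicity, has no multiple points), and $\mathcal S^{(k)}$ has the same law as $\mathcal T^{(k)}$ as a point process: $\mathcal S^{(k)}=_d\mathcal T^{(k)}$, that is, the random counting measures $A\mapsto\#(\mathcal S^{(k)}\cap A)$ and $A\mapsto\#(\mathcal T^{(k)}\cap A)$ have the same distribution. -/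

import Mathlib

open MeasureTheory ProbabilityTheory Set
open scoped ENNReal

noncomputable section

/-- The counting measure carried by a set of points: `pointMeasure S A` is the number of points of
`S` in the measurable set `A`. A simple point process is handled as a random set `T : Ω → Set E`;
its law is the law of the random measure `ω ↦ pointMeasure (T ω)`, where `Measure E` carries the
σ-algebra generated by the evaluations `μ ↦ μ A`, `A` measurable. -/
def pointMeasure {E : Type*} [MeasurableSpace E] (S : Set E) : Measure E :=
  Measure.count.restrict S

/-- The random set `T` is a (simple) Poisson point process with intensity measure `Λ`:
it is a random measure, the number of points in `A` is Poisson distributed with mean `Λ A`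
(a.s. infinite if `Λ A = ∞`), and the numbers of points in disjoint sets are independent. -/
structure IsPoissonProcess {Ω E : Type*} [MeasurableSpace Ω] [MeasurableSpace E]
    (T : Ω → Set E) (Λ : Measure E) (P : Measure Ω) : Prop where
  measurable : Measurable fun ω => pointMeasure (T ω)
  law : ∀ A : Set E, MeasurableSet A → Λ A ≠ ∞ →
    HasLaw (fun ω => pointMeasure (T ω) A)
      ((poissonMeasure (Λ A).toNNReal).map fun n : ℕ => (n : ℝ≥0∞)) P
  infinite : ∀ A : Set E, MeasurableSet A → Λ A = ∞ → ∀ᵐ ω ∂P, pointMeasure (T ω) A = ∞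
  indep : ∀ (n : ℕ) (A : Fin n → Set E), (∀ i, MeasurableSet (A i)) →
    Pairwise (fun i j => Disjoint (A i) (A j)) →
    iIndepFun (fun i ω => pointMeasure (T ω) (A i)) P

/-- The measure `(k / t) dt` on `(0, ∞)`, as a measure on `ℝ` that does not charge `(-∞, 0]`. -/
def selfSimilarIntensity (k : ℝ) : Measure ℝ :=
  (volume.restrict (Ioi 0)).withDensity fun t => ENNReal.ofReal (k / t)

/-- `s < t` are consecutive points of `T`. -/
def IsConsecutive (T : Set ℝ) (s t : ℝ) : Prop :=
  s < t ∧ Icc s t ∩ T = {s, t}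

/-- The set of spacings between consecutive points of `T`. -/
def spacings (T : Set ℝ) : Set ℝ :=
  {d | ∃ s t, IsConsecutive T s t ∧ d = t - s}

end

open Filter Topology

/-! A test function `g` with values in `[0, 1]`, equal to 1 off `(a, b)`, is multiplied over the
spacings. Let `φ t` be the expected product over the spacings of the points before `t`, with `t`
itself added as a last point. The last point before `t` has density `k s^(k-1) / t^k`, since `[s,
t)` is empty with probability `(s/t)^k`; and the points before `s` are independent of those after.
This gives the renewal equation `t^k φ(t) = ∫₀ᵗ k s^(k-1) φ(s) g(t-s) ds`.

With `M`, `G` the Laplace transforms of `t^(k-1) φ` and `g`, the equation reads `M' = -k M G`, so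
`r^k M(r) exp(∫ (1 - g(x)) (k/x) e^(-rx) dx)` is constant in `r`. Its limit at `r = ∞` sees `φ = 1`
near zero, and its limit at `r = 0` sees `φ(∞)`; comparing them gives `φ(∞) = exp(-∫ (1 - g) k/x)`,
the generating functional of the Poisson process (`limit_of_renewal`). Far out the spacings exceed
`b` and are invisible to `g`, so `φ(∞)` is the expected product over all spacings
(`integral_spacingProd_of_continuous`).

The renewal equation is proved without conditioning on a point of the process: on a grid of width
`h` it is a finite sum using independence of cells (`integral_gridProd`), and then `h → 0`
(`rpow_mul_integral_spacingProdBefore`).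

Equality of generating functionals gives equality of laws for the spacings counted with multiplicity
(`identDistrib_spacingMeasure`), through moments of the exponentiated masses of rational intervals
(`ext_of_moments`). Absence of multiple points is a measurable property of the law, so the spacings
inherit it from `T`; the multiplicities can then be dropped. -/

/-! ### Laplace transforms and the solution of the renewal equation -/

theorem hasDerivAt_integral_mul_exp_neg {h : ℝ → ℝ}
    (hm : Measurable h)
    (hi : ∀ r : ℝ, 0 < r → IntegrableOn (fun t => h t * Real.exp (-(r * t))) (Ioi 0))
    (hi' : ∀ r : ℝ, 0 < r → IntegrableOn (fun t => t * h t * Real.exp (-(r * t))) (Ioi 0))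
    {r : ℝ} (hr : 0 < r) :
    HasDerivAt (fun r => ∫ t in Ioi 0, h t * Real.exp (-(r * t)))
      (-∫ t in Ioi 0, t * h t * Real.exp (-(r * t))) r := by
  rw [← integral_neg]
  refine (hasDerivAt_integral_of_dominated_loc_of_deriv_le (μ := volume.restrict (Ioi (0 : ℝ)))
    (F := fun r t => h t * Real.exp (-(r * t)))
    (F' := fun r t => -(t * h t * Real.exp (-(r * t))))
    -- On the neighbourhood `(r / 2, ∞)` of `r`, the weight at rate `r / 2` dominates all the
    -- others.
    (bound := fun t => ‖t * h t * Real.exp (-(r / 2 * t))‖) (s := Ioi (r / 2))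
    (Ioi_mem_nhds (by linarith)) (Eventually.of_forall fun x => ?_) (hi r hr) ?_ ?_ ?_ ?_).2
  · exact (by fun_prop : Measurable fun t => h t * Real.exp (-(x * t))).aestronglyMeasurable
  · exact (by fun_prop :
      Measurable fun t => -(t * h t * Real.exp (-(r * t)))).aestronglyMeasurable
  · filter_upwards [ae_restrict_mem measurableSet_Ioi] with t ht x hx
    simp only [mem_Ioi] at ht hx
    rw [norm_neg, norm_mul, norm_mul (t * h t)]
    gcongr
    rw [Real.norm_of_nonneg (Real.exp_pos _).le, Real.norm_of_nonneg (Real.exp_pos _).le]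
    gcongr
  · exact (hi' (r / 2) (by linarith)).norm
  · refine Eventually.of_forall fun t x _ => ?_
    have h1 : HasDerivAt (fun r : ℝ => Real.exp (-(r * t))) (Real.exp (-(x * t)) * (-(1 * t))) x :=
      (((hasDerivAt_id x).mul_const t).neg).exp
    convert! h1.const_mul (h t) using 1
    ring

theorem integrableOn_rpow_mul_exp_neg {k r : ℝ} (hk : 0 < k) (hr : 0 < r) :
    IntegrableOn (fun t : ℝ => t ^ (k - 1) * Real.exp (-(r * t))) (Ioi 0) := by
  have := integrableOn_rpow_mul_exp_neg_mul_rpow (s := k - 1) (p := 1) (by linarith) one_pos hr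
  simpa [neg_mul] using this

theorem integrableOn_rpow_mul_mul_exp_neg {k r : ℝ} (hk : 0 < k) (hr : 0 < r) {φ : ℝ → ℝ}
    (hm : Measurable φ) (h01 : ∀ t, φ t ∈ Icc (0 : ℝ) 1) :
    IntegrableOn (fun t : ℝ => t ^ (k - 1) * φ t * Real.exp (-(r * t))) (Ioi 0) := by
  refine Integrable.mono' (integrableOn_rpow_mul_exp_neg hk hr)
    (by fun_prop : Measurable fun t : ℝ =>
      t ^ (k - 1) * φ t * Real.exp (-(r * t))).aestronglyMeasurable
    ?_
  filter_upwards [ae_restrict_mem measurableSet_Ioi] with t ht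
  have ht' : (0 : ℝ) < t := ht
  obtain ⟨h0, h1⟩ := h01 t
  rw [Real.norm_of_nonneg (by positivity)]
  gcongr
  exact mul_le_of_le_one_right (by positivity) h1

section Renewal

variable {k a b : ℝ} {g φ : ℝ → ℝ}

theorem integrableOn_one_sub_mul_div (ha : 0 < a) (hg : Continuous g)
    (hg1 : ∀ x, x ∉ Icc a b → g x = 1) :
    IntegrableOn (fun x => (1 - g x) * (k / x)) (Ioi 0) := by
  have h1 : IntegrableOn (fun x => (1 - g x) * (k / x)) (Icc a b) := by
    refine ContinuousOn.integrableOn_Icc ?_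
    refine (by fun_prop : ContinuousOn (fun x => 1 - g x) (Icc a b)).mul ?_
    refine continuousOn_const.div continuousOn_id fun x hx => ?_
    exact (ha.trans_le hx.1).ne'
  have h2 : (fun x => (1 - g x) * (k / x)) = (Icc a b).indicator fun x => (1 - g x) * (k / x) := by
    ext x
    by_cases hx : x ∈ Icc a b
    · simp [hx]
    · simp [hx, hg1 x hx]
  rw [h2]
  exact ((integrable_indicator_iff measurableSet_Icc).2 h1).integrableOn

/-- A Tauberian computation: a bounded solution of the self-similar renewal equation which equals
`1` near zero has an explicit limit at infinity. -/
theorem limit_of_renewal (hk : 0 < k) (ha : 0 < a) (hg : Continuous g)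
    (hg01 : ∀ x, g x ∈ Icc (0 : ℝ) 1) (hg1 : ∀ x, x ∉ Icc a b → g x = 1)
    (hφm : Measurable φ) (hφ01 : ∀ t, φ t ∈ Icc (0 : ℝ) 1) (hφ1 : ∀ t, 0 < t → t ≤ a → φ t = 1)
    (heq : ∀ t, 0 < t → t ^ k * φ t = ∫ s in (0 : ℝ)..t, k * s ^ (k - 1) * φ s * g (t - s))
    {c : ℝ} (hlim : Tendsto φ atTop (𝓝 c)) :
    c = Real.exp (-∫ x in Ioi 0, (1 - g x) * (k / x)) := by
  set M : ℝ → ℝ := fun r => ∫ t in Ioi 0, t ^ (k - 1) * φ t * Real.exp (-(r * t)) with hM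
  set G : ℝ → ℝ := fun r => ∫ t in Ioi 0, g t * Real.exp (-(r * t)) with hG
  set H : ℝ → ℝ := fun r => ∫ x in Ioi 0, (1 - g x) * (k / x) * Real.exp (-(r * x)) with hH
  have hexp : ∀ r : ℝ, 0 < r → IntegrableOn (fun t => Real.exp (-(r * t))) (Ioi 0) := fun r hr => by
    simpa using integrableOn_rpow_mul_exp_neg one_pos hr
  have hgi : ∀ r : ℝ, 0 < r → IntegrableOn (fun t => g t * Real.exp (-(r * t))) (Ioi 0) :=
    fun r hr => by simpa using integrableOn_rpow_mul_mul_exp_neg one_pos hr hg.measurable hg01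
  have hMi := fun r (hr : 0 < r) => integrableOn_rpow_mul_mul_exp_neg hk hr hφm hφ01
  have hMi' : ∀ r : ℝ, 0 < r →
      IntegrableOn (fun t => t * (t ^ (k - 1) * φ t) * Real.exp (-(r * t))) (Ioi 0) := by
    intro r hr
    refine (integrableOn_rpow_mul_mul_exp_neg (k := k + 1) (by linarith) hr hφm hφ01).congr_fun
      (fun t ht => ?_) measurableSet_Ioi
    have ht' : (0 : ℝ) < t := ht
    have : t ^ (k + 1 - 1) = t * t ^ (k - 1) := by
      rw [show k + 1 - 1 = 1 + (k - 1) by ring, Real.rpow_add ht', Real.rpow_one]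
    simp only [this]
    ring
  -- The transform of `t ^ k * φ t` is `-M'`, while the right side of `heq` is `k` times the
  -- convolution of `t ^ (k - 1) * φ t` with `g`, whose transform is `M * G`.
  have hMd : ∀ r : ℝ, 0 < r → HasDerivAt M (-(k * M r * G r)) r := by
    intro r hr
    have h1 := hasDerivAt_integral_mul_exp_neg (h := fun t => t ^ (k - 1) * φ t) (by fun_prop)
      hMi hMi' hr
    have h2 := integral_posConvolution (hMi r hr) (hgi r hr) (ContinuousLinearMap.mul ℝ ℝ)
    simp only [ContinuousLinearMap.mul_apply'] at h2
    convert! h1 using 2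
    rw [mul_assoc, hM, hG, ← h2, ← integral_const_mul]
    refine setIntegral_congr_fun measurableSet_Ioi fun t ht => ?_
    have ht' : (0 : ℝ) < t := ht
    have e : t * (t ^ (k - 1) * φ t) = t ^ k * φ t := by
      rw [← mul_assoc]
      congr 1
      nth_rewrite 1 [← Real.rpow_one t]
      rw [← Real.rpow_add ht']; congr 1; ring
    simp only [e]
    rw [heq t ht', ← intervalIntegral.integral_const_mul, ← intervalIntegral.integral_mul_const]
    refine intervalIntegral.integral_congr fun s _ => ?_
    have : Real.exp (-(r * t)) = Real.exp (-(r * s)) * Real.exp (-(r * (t - s))) := by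
      rw [← Real.exp_add]; congr 1; ring
    simp only [this]
    ring
  have hHi0 := integrableOn_one_sub_mul_div (k := k) ha hg hg1
  have hHi : ∀ r : ℝ, 0 < r →
      IntegrableOn (fun x => (1 - g x) * (k / x) * Real.exp (-(r * x))) (Ioi 0) := by
    intro r hr
    refine Integrable.mono hHi0 (Measurable.aestronglyMeasurable
      (by have := hg.measurable; fun_prop)) ?_
    filter_upwards [ae_restrict_mem measurableSet_Ioi] with t ht
    have ht' : (0 : ℝ) < t := ht
    rw [norm_mul]
    refine mul_le_of_le_one_right (norm_nonneg _) ?_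
    rw [Real.norm_of_nonneg (Real.exp_pos _).le, Real.exp_le_one_iff]
    have := mul_pos hr ht'
    linarith
  -- The factor `x` produced by differentiating `H` cancels the singular density `k / x`, leaving
  -- only `G` and an elementary transform.
  have e1 : ∀ r x : ℝ, 0 < x → x * ((1 - g x) * (k / x)) * Real.exp (-(r * x)) =
      k * Real.exp (-(r * x)) - k * (g x * Real.exp (-(r * x))) := by
    intro r x hx
    field_simp
  have hHd : ∀ r : ℝ, 0 < r → HasDerivAt H (-(k / r) + k * G r) r := by
    intro r hr
    have h1 := hasDerivAt_integral_mul_exp_neg (h := fun x => (1 - g x) * (k / x))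
      (by have := hg.measurable; fun_prop) hHi (fun r hr => ?_) hr
    · convert! h1 using 1
      rw [setIntegral_congr_fun measurableSet_Ioi fun x hx => e1 r x hx, integral_sub,
        integral_const_mul, integral_const_mul]
      · have := integral_exp_mul_Ioi (neg_lt_zero.2 hr) 0
        simp only [neg_mul, mul_zero, Real.exp_zero] at this
        rw [this]
        simp only [hG]
        field_simp
        ring
      · exact (hexp r hr).const_mul k
      · exact (hgi r hr).const_mul k
    · refine IntegrableOn.congr_fun ?_ (fun x hx => (e1 r x hx).symm) measurableSet_Ioi
      exact ((hexp r hr).const_mul k).sub ((hgi r hr).const_mul k)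
  -- The logarithmic derivatives of the three factors are `k / r`, `-k G` and `-k / r + k G`, which
  -- cancel.
  set R : ℝ → ℝ := fun r => r ^ k * M r * Real.exp (H r) with hR
  have hRd : ∀ r : ℝ, 0 < r → HasDerivAt R 0 r := by
    intro r hr
    have h1 := ((Real.hasDerivAt_rpow_const (p := k) (Or.inl hr.ne')).mul (hMd r hr)).mul
      (hHd r hr).exp
    convert! h1 using 1
    have : r ^ (k - 1) = r ^ k / r := Real.rpow_sub_one hr.ne' k
    simp only [this, Pi.mul_apply]
    field_simp
    ring
  have hRc : ∀ r ∈ Ioi (0 : ℝ), R r = R 1 := fun r hr =>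
    isOpen_Ioi.is_const_of_deriv_eq_zero isPreconnected_Ioi
      (fun x hx => (hRd x hx).differentiableAt.differentiableWithinAt)
      (fun x hx => (hRd x hx).deriv) hr (mem_Ioi.2 one_pos)
  -- The substitution `u = r * t` moves `r` into the argument of `φ`, so that `r → ∞` and `r → 0+`
  -- read off `φ` at zero and at infinity.
  have hscale : ∀ r : ℝ, 0 < r →
      r ^ k * M r = ∫ u in Ioi 0, u ^ (k - 1) * φ (u / r) * Real.exp (-(1 * u)) := by
    intro r hr
    have h1 := integral_comp_mul_left_Ioi
      (fun u => u ^ (k - 1) * φ (u / r) * Real.exp (-(1 * u))) 0 hr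
    simp only [mul_zero, smul_eq_mul] at h1
    have h2 : ∫ u in Ioi 0, u ^ (k - 1) * φ (u / r) * Real.exp (-(1 * u)) =
      r * ∫ x in Ioi 0, (r * x) ^ (k - 1) * φ (r * x / r) * Real.exp (-(1 * (r * x))) := by
      rw [h1]; field_simp
    rw [h2, hM, ← integral_const_mul, ← integral_const_mul]
    refine setIntegral_congr_fun measurableSet_Ioi fun x hx => ?_
    have hx' : (0 : ℝ) < x := hx
    simp only [mul_div_cancel_left₀ x hr.ne', Real.mul_rpow hr.le hx'.le, one_mul]
    have : r ^ k = r * r ^ (k - 1) := by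
      rw [Real.rpow_sub_one hr.ne']; field_simp
    rw [this]; ring
  have hMlim : ∀ (l : Filter ℝ) [l.IsCountablyGenerated] (c : ℝ), (∀ᶠ r in l, 0 < r) →
      (∀ u : ℝ, 0 < u → Tendsto (fun r => φ (u / r)) l (𝓝 c)) →
      Tendsto (fun r => r ^ k * M r) l
        (𝓝 (∫ u in Ioi 0, u ^ (k - 1) * c * Real.exp (-(1 * u)))) := by
    intro l _ c hl hc
    refine Tendsto.congr' (hl.mono fun r hr => (hscale r hr).symm) ?_
    refine tendsto_integral_filter_of_dominated_convergence
      (fun u : ℝ => u ^ (k - 1) * Real.exp (-(1 * u))) (Eventually.of_forall fun r => ?_)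
      (Eventually.of_forall fun r => ?_) (integrableOn_rpow_mul_exp_neg hk one_pos) ?_
    · exact (by fun_prop : Measurable fun u : ℝ =>
        u ^ (k - 1) * φ (u / r) * Real.exp (-(1 * u))).aestronglyMeasurable
    · filter_upwards [ae_restrict_mem measurableSet_Ioi] with u hu
      have hu' : (0 : ℝ) < u := hu
      obtain ⟨h0, h1⟩ := hφ01 (u / r)
      rw [Real.norm_of_nonneg (by positivity)]
      gcongr
      exact mul_le_of_le_one_right (by positivity) h1
    · filter_upwards [ae_restrict_mem measurableSet_Ioi] with u hu
      exact ((hc u hu).const_mul _).mul_const _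
  have hHlim : ∀ (l : Filter ℝ) [l.IsCountablyGenerated] (e : ℝ → ℝ), (∀ᶠ r in l, 0 < r) →
      (∀ x : ℝ, 0 < x → Tendsto (fun r => Real.exp (-(r * x))) l (𝓝 (e x))) →
      Tendsto H l (𝓝 (∫ x in Ioi 0, (1 - g x) * (k / x) * e x)) := by
    intro l _ e hl he
    refine tendsto_integral_filter_of_dominated_convergence
      (fun x : ℝ => ‖(1 - g x) * (k / x)‖) (Eventually.of_forall fun r => ?_)
      (hl.mono fun r hr => ?_) hHi0.norm ?_
    · exact Measurable.aestronglyMeasurable (by have := hg.measurable; fun_prop)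
    · filter_upwards [ae_restrict_mem measurableSet_Ioi] with t ht
      have ht' : (0 : ℝ) < t := ht
      rw [norm_mul]
      refine mul_le_of_le_one_right (norm_nonneg _) ?_
      rw [Real.norm_of_nonneg (Real.exp_pos _).le, Real.exp_le_one_iff]
      have := mul_pos hr ht'
      linarith
    · filter_upwards [ae_restrict_mem measurableSet_Ioi] with u hu
      exact (he u hu).const_mul _
  have hpos0 : ∀ᶠ r in 𝓝[>] (0 : ℝ), 0 < r := eventually_mem_nhdsWithin
  -- As `r → ∞`, `φ (u / r)` is eventually 1 and `H r → 0`, so `R` tends to `Γ(k)`.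
  have hA := (hMlim atTop 1 (eventually_gt_atTop 0) fun u hu => by
      refine tendsto_const_nhds.congr' ?_
      filter_upwards [eventually_ge_atTop (u / a), eventually_gt_atTop 0] with r hr hr0
      refine (hφ1 _ (div_pos hu hr0) ?_).symm
      rw [div_le_iff₀ hr0]
      rwa [div_le_iff₀ ha, mul_comm] at hr).mul
    ((hHlim atTop (fun _ => 0) (eventually_gt_atTop 0) fun x hx =>
      Real.tendsto_exp_neg_atTop_nhds_zero.comp (tendsto_id.atTop_mul_const hx)).rexp)
  -- As `r → 0+`, `φ (u / r) → c` and the exponential weight in `H` disappears.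
  have hB := (hMlim (𝓝[>] 0) c hpos0 fun u hu => by
      refine hlim.comp ?_
      exact (tendsto_inv_nhdsGT_zero.const_mul_atTop hu)).mul
    ((hHlim (𝓝[>] 0) (fun _ => 1) hpos0 fun x hx => by
      have : Continuous fun r : ℝ => Real.exp (-(r * x)) := by fun_prop
      simpa using (this.tendsto 0).mono_left nhdsWithin_le_nhds).rexp)
  have hA' : Tendsto R atTop (𝓝 (R 1)) :=
    tendsto_const_nhds.congr' ((eventually_gt_atTop 0).mono fun r hr => (hRc r hr).symm)
  have hB' : Tendsto R (𝓝[>] 0) (𝓝 (R 1)) :=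
    tendsto_const_nhds.congr' (hpos0.mono fun r hr => (hRc r hr).symm)
  have hAB := (tendsto_nhds_unique hA hA').trans (tendsto_nhds_unique hB hB').symm
  have hΓ : ∫ u in Ioi (0 : ℝ), u ^ (k - 1) * Real.exp (-(1 * u)) = Real.Gamma k := by
    rw [Real.Gamma_eq_integral hk]
    refine setIntegral_congr_fun measurableSet_Ioi fun u _ => ?_
    simp [mul_comm]
  have hΓc : ∫ u in Ioi (0 : ℝ), u ^ (k - 1) * c * Real.exp (-(1 * u)) = c * Real.Gamma k := by
    rw [← hΓ, ← integral_const_mul]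
    congr 1; ext u; ring
  simp only [mul_one, mul_zero, integral_zero, Real.exp_zero, hΓ, hΓc] at hAB
  have hΓpos := Real.Gamma_pos_of_pos hk
  rw [Real.exp_neg, ← one_div, eq_div_iff (Real.exp_pos _).ne']
  have : Real.Gamma k * (c * Real.exp (∫ x in Ioi 0, (1 - g x) * (k / x))) = Real.Gamma k * 1 := by
    linarith
  exact mul_left_cancel₀ hΓpos.ne' this

end Renewal

/-! ### Deterministic configurations and products over their spacings -/

/-- The almost sure path properties of the self-similar Poisson process that the deterministic part
of the argument uses: the points are positive, locally finite in `(0, ∞)`, accumulate at `0`, and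
far from the origin any two of them are far apart. -/
structure IsSparseConfiguration (D : Set ℝ) : Prop where
  pos : ∀ t ∈ D, 0 < t
  finite : ∀ a b, 0 < a → (D ∩ Icc a b).Finite
  exists_lt : ∀ ε, 0 < ε → ∃ t ∈ D, t < ε
  sparse : ∀ b, 0 < b → ∃ M, ∀ s ∈ D, ∀ t ∈ D, M ≤ t → s < t → b ≤ t - s

/-- The last point of `D` strictly before `t`. -/
noncomputable def lastBefore (D : Set ℝ) (t : ℝ) : ℝ := sSup (D ∩ Iio t)

namespace IsSparseConfiguration

variable {D : Set ℝ} {g : ℝ → ℝ} {a b t : ℝ}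

/-- Points can accumulate only at 0: above any point `u < t` of `D`, finitely many points lie below
`t`, and one of them is the largest. -/
theorem exists_lastBefore (hD : IsSparseConfiguration D) (ht : 0 < t) :
    ∃ p ∈ D, p < t ∧ ∀ s ∈ D, s < t → s ≤ p := by
  obtain ⟨u, huD, hut⟩ := hD.exists_lt t ht
  have hu := hD.pos u huD
  have hfin : (D ∩ Ico u t).Finite :=
    (hD.finite u t hu).subset (inter_subset_inter_right _ Ico_subset_Icc_self)
  obtain ⟨p, hp, hmax⟩ := hfin.exists_maximalFor id _ ⟨u, huD, le_refl u, hut⟩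
  refine ⟨p, hp.1, hp.2.2, fun s hs hst => ?_⟩
  by_contra! h
  have := hmax (j := s) ⟨hs, hp.2.1.trans h.le, hst⟩ h.le
  exact absurd this (not_le.2 h)

theorem lastBefore_eq {p : ℝ} (hp : p ∈ D) (hpt : p < t) (hmax : ∀ s ∈ D, s < t → s ≤ p) :
    lastBefore D t = p :=
  IsGreatest.csSup_eq ⟨⟨hp, hpt⟩, fun s hs => hmax s hs.1 hs.2⟩

theorem lastBefore_mem (hD : IsSparseConfiguration D) (ht : 0 < t) : lastBefore D t ∈ D := by
  obtain ⟨p, hp, hpt, hmax⟩ := hD.exists_lastBefore ht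
  rwa [lastBefore_eq hp hpt hmax]

theorem lastBefore_lt (hD : IsSparseConfiguration D) (ht : 0 < t) : lastBefore D t < t := by
  obtain ⟨p, hp, hpt, hmax⟩ := hD.exists_lastBefore ht
  rwa [lastBefore_eq hp hpt hmax]

theorem le_lastBefore (hD : IsSparseConfiguration D) {s : ℝ} (hs : s ∈ D) (hst : s < t) :
    s ≤ lastBefore D t := by
  obtain ⟨p, hp, hpt, hmax⟩ := hD.exists_lastBefore ((hD.pos s hs).trans hst)
  rw [lastBefore_eq hp hpt hmax]
  exact hmax s hs hst

theorem lastBefore_pos (hD : IsSparseConfiguration D) (ht : 0 < t) : 0 < lastBefore D t :=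
  hD.pos _ (hD.lastBefore_mem ht)

/-- Spacings are thereby indexed by their right end point, one for each point of `D`. -/
theorem isConsecutive_iff (hD : IsSparseConfiguration D) {s : ℝ} :
    IsConsecutive D s t ↔ t ∈ D ∧ s = lastBefore D t := by
  constructor
  · rintro ⟨hst, h⟩
    have hs : s ∈ Icc s t ∩ D := h ▸ mem_insert s {t}
    have ht : t ∈ Icc s t ∩ D := h ▸ mem_insert_of_mem s rfl
    refine ⟨ht.2, (lastBefore_eq hs.2 hst fun u hu hut => ?_).symm⟩
    by_contra! hsu
    have : u ∈ ({s, t} : Set ℝ) := h ▸ ⟨⟨hsu.le, hut.le⟩, hu⟩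
    rcases this with h | h
    · exact hsu.ne' h
    · exact hut.ne h
  · rintro ⟨ht, rfl⟩
    have h0 := hD.pos t ht
    refine ⟨hD.lastBefore_lt h0, Subset.antisymm ?_ ?_⟩
    · rintro u ⟨⟨h1, h2⟩, hu⟩
      rcases h2.eq_or_lt with h | h
      · exact Or.inr h
      · exact Or.inl ((hD.le_lastBefore hu h).antisymm h1)
    · rintro u (rfl | rfl)
      · exact ⟨⟨le_rfl, (hD.lastBefore_lt h0).le⟩, hD.lastBefore_mem h0⟩
      · exact ⟨⟨(hD.lastBefore_lt h0).le, le_rfl⟩, ht⟩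

theorem spacings_eq_image (hD : IsSparseConfiguration D) :
    spacings D = (fun t => t - lastBefore D t) '' D := by
  ext d
  simp only [spacings, hD.isConsecutive_iff, mem_ofPred_eq, mem_image]
  constructor
  · rintro ⟨s, t, ⟨ht, rfl⟩, rfl⟩
    exact ⟨t, ht, rfl⟩
  · rintro ⟨t, ht, rfl⟩
    exact ⟨_, t, ⟨ht, rfl⟩, rfl⟩

/-- A spacing above `a` forces its right end point above `a`, and sparseness bounds the end points
of spacings below `b`. Hence the products of `g` over spacings have finitely many factors different
from 1. -/
theorem finite_spacing_mem (hD : IsSparseConfiguration D) (ha : 0 < a) (b : ℝ) :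
    {s ∈ D | s - lastBefore D s ∈ Ioo a b}.Finite := by
  obtain ⟨M, hM⟩ := hD.sparse (max b 1) (by positivity)
  refine (hD.finite a M ha).subset ?_
  rintro s ⟨hs, h1, h2⟩
  have h0 := hD.pos s hs
  refine ⟨hs, ?_, ?_⟩
  · have := hD.lastBefore_pos h0
    linarith
  · by_contra! h
    have := hM _ (hD.lastBefore_mem h0) s hs h.le (hD.lastBefore_lt h0)
    exact absurd (h2.trans_le ((le_max_left b 1).trans this)) (lt_irrefl _)

end IsSparseConfiguration

/-- The product of `g` over the spacings of `D ∩ (0, t)` completed by the point `t`. -/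
noncomputable def spacingProdBefore (g : ℝ → ℝ) (D : Set ℝ) (t : ℝ) : ℝ :=
  g (t - lastBefore D t) * ∏ᶠ s ∈ D ∩ Iio t, g (s - lastBefore D s)

/-- The product of `g` over all spacings of `D`. -/
noncomputable def spacingProd (g : ℝ → ℝ) (D : Set ℝ) : ℝ :=
  ∏ᶠ s ∈ D, g (s - lastBefore D s)

namespace IsSparseConfiguration

variable {D : Set ℝ} {g : ℝ → ℝ} {a b t : ℝ}

theorem spacingProdBefore_of_le (hD : IsSparseConfiguration D)
    (hg1 : ∀ x, x ∉ Ioo a b → g x = 1) (ht : 0 < t) (hta : t ≤ a) :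
    spacingProdBefore g D t = 1 := by
  have key : ∀ s, 0 < s → s ≤ a → g (s - lastBefore D s) = 1 := fun s hs hsa => by
    refine hg1 _ fun h => ?_
    have := hD.lastBefore_pos hs
    have := h.1
    linarith
  rw [spacingProdBefore, key t ht hta, one_mul]
  exact finprod_mem_eq_one_of_forall_eq_one fun s hs => key s (hD.pos s hs.1) (hs.2.le.trans hta)

/-- Removing the last point `p` before `t` from the product leaves the product below `p`, in which
`p` plays the role of the completing point. -/
theorem spacingProdBefore_eq (hD : IsSparseConfiguration D) (ha : 0 < a)
    (hg1 : ∀ x, x ∉ Ioo a b → g x = 1) (ht : 0 < t) :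
    spacingProdBefore g D t = g (t - lastBefore D t) * spacingProdBefore g D (lastBefore D t) := by
  rw [spacingProdBefore, spacingProdBefore]
  congr 1
  set p := lastBefore D t
  have hins : D ∩ Iio t = insert p (D ∩ Iio p) := by
    ext s
    constructor
    · rintro ⟨hs, hst⟩
      rcases (hD.le_lastBefore hs hst).eq_or_lt with h | h
      · exact Or.inl h
      · exact Or.inr ⟨hs, h⟩
    · rintro (rfl | ⟨hs, hsp⟩)
      · exact ⟨hD.lastBefore_mem ht, hD.lastBefore_lt ht⟩
      · exact ⟨hs, hsp.trans (hD.lastBefore_lt ht)⟩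
  rw [hins, finprod_mem_insert' _ (by simp)]
  refine (hD.finite_spacing_mem ha b).subset ?_
  rintro s ⟨hs, hs'⟩
  exact ⟨hs.1, by by_contra h; exact hs' (hg1 _ h)⟩

/-- Two discrepancies have to be invisible to `g`: the artificial spacing ending at `t` exceeds `b`
because the window is empty, and the spacings of points beyond `t` are at least `b` by sparseness.
-/
theorem spacingProdBefore_eq_spacingProd (hD : IsSparseConfiguration D)
    (hb : 0 < b) (hg1 : ∀ x, x ∉ Ioo a b → g x = 1) :
    ∃ M, ∀ t, M ≤ t → D ∩ Ico (t - b) t = ∅ → spacingProdBefore g D t = spacingProd g D := by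
  obtain ⟨M, hM⟩ := hD.sparse b hb
  refine ⟨max M 1, fun t ht hemp => ?_⟩
  have ht0 : 0 < t := lt_of_lt_of_le one_pos ((le_max_right _ _).trans ht)
  have h1 : g (t - lastBefore D t) = 1 := by
    refine hg1 _ fun h => ?_
    have : lastBefore D t ∈ D ∩ Ico (t - b) t :=
      ⟨hD.lastBefore_mem ht0, by linarith [h.2], hD.lastBefore_lt ht0⟩
    rw [hemp] at this
    exact this
  rw [spacingProdBefore, h1, one_mul, spacingProd]
  refine finprod_mem_inter_mulSupport_eq _ _ _ ?_
  ext s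
  constructor
  · rintro ⟨⟨hs, _⟩, hs'⟩
    exact ⟨hs, hs'⟩
  · rintro ⟨hs, hs'⟩
    refine ⟨⟨hs, ?_⟩, hs'⟩
    by_contra! h
    have h0 := hD.pos s hs
    refine hs' (hg1 _ fun hlt => ?_)
    have := hM _ (hD.lastBefore_mem h0) s hs (((le_max_left _ _).trans ht).trans (not_lt.1 h))
      (hD.lastBefore_lt h0)
    exact absurd hlt.2 (not_lt.2 this)

end IsSparseConfiguration

/-! ### Discretization on a grid and its limit -/

open Classical in
/-- The indicator that `D` has no point in the grid cells `i, …, j - 1` of width `h`. -/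
noncomputable def vacancy (D : Set ℝ) (h : ℝ) (i j : ℕ) : ℝ :=
  if D ∩ Ico (i * h) (j * h) = ∅ then 1 else 0

/-- The product of `g` over the spacings of the discretization of `D` to the grid of width `h`,
completed by the grid point `j`. -/
noncomputable def gridProd (g : ℝ → ℝ) (D : Set ℝ) (h : ℝ) : ℕ → ℝ
  | 0 => 1
  -- The difference of vacancies is the indicator that cell `i` is the last occupied cell before `j
  -- + 1`, so at most one term survives. In this form the factor depends on cells from `i` on, and
  -- the recursive value on cells before `i`.
  | j + 1 => ∑ i : Fin (j + 1), (vacancy D h (i + 1) (j + 1) - vacancy D h i (j + 1)) *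
      g (((j + 1 : ℕ) - (i : ℕ)) * h) * gridProd g D h i

theorem gridProd_of_pos (g : ℝ → ℝ) (D : Set ℝ) (h : ℝ) {j : ℕ} (hj : 0 < j) :
    gridProd g D h j = ∑ i ∈ Finset.range j, (vacancy D h (i + 1) j - vacancy D h i j) *
      g ((j - i) * h) * gridProd g D h i := by
  obtain ⟨j, rfl⟩ := Nat.exists_eq_add_one.2 hj
  rw [gridProd, Finset.sum_range]

theorem vacancy_nonneg (D : Set ℝ) (h : ℝ) (i j : ℕ) : 0 ≤ vacancy D h i j := by
  unfold vacancy; split_ifs <;> norm_num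

theorem vacancy_le_one (D : Set ℝ) (h : ℝ) (i j : ℕ) : vacancy D h i j ≤ 1 := by
  unfold vacancy; split_ifs <;> norm_num

theorem vacancy_mono (D : Set ℝ) {h : ℝ} (hh : 0 ≤ h) {i i' : ℕ} (hi : i ≤ i') (j : ℕ) :
    vacancy D h i j ≤ vacancy D h i' j := by
  by_cases h1 : D ∩ Ico (i * h) (j * h) = ∅
  · have h2 : D ∩ Ico (i' * h) (j * h) = ∅ := by
      refine subset_empty_iff.1 (h1 ▸ inter_subset_inter_right _ (Ico_subset_Ico_left ?_))
      gcongr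
    simp [vacancy, h1, h2]
  · rw [vacancy, if_neg h1]
    exact vacancy_nonneg _ _ _ _

theorem vacancy_self (D : Set ℝ) (h : ℝ) (j : ℕ) : vacancy D h j j = 1 := by
  simp [vacancy]

theorem sum_vacancy_sub (D : Set ℝ) (h : ℝ) (j : ℕ) :
    ∑ i ∈ Finset.range j, (vacancy D h (i + 1) j - vacancy D h i j) = 1 - vacancy D h 0 j := by
  rw [Finset.sum_range_sub (fun i => vacancy D h i j), vacancy_self]

theorem gridProd_mem_Icc {g : ℝ → ℝ} (hg01 : ∀ x, g x ∈ Icc (0 : ℝ) 1) (D : Set ℝ) {h : ℝ}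
    (hh : 0 ≤ h) (j : ℕ) : gridProd g D h j ∈ Icc (0 : ℝ) 1 := by
  induction j using Nat.strong_induction_on with
  | _ j ih =>
    rcases Nat.eq_zero_or_pos j with rfl | hj
    · simp [gridProd]
    rw [gridProd_of_pos g D h hj]
    have hw : ∀ i, 0 ≤ vacancy D h (i + 1) j - vacancy D h i j := fun i =>
      sub_nonneg.2 (vacancy_mono D hh (Nat.le_succ i) j)
    constructor
    · refine Finset.sum_nonneg fun i hi => ?_
      exact mul_nonneg (mul_nonneg (hw i) (hg01 _).1) (ih i (Finset.mem_range.1 hi)).1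
    · calc _ ≤ ∑ i ∈ Finset.range j, (vacancy D h (i + 1) j - vacancy D h i j) := by
            refine Finset.sum_le_sum fun i hi => ?_
            have h1 := ih i (Finset.mem_range.1 hi)
            rw [mul_assoc]
            exact mul_le_of_le_one_right (hw i) (mul_le_one₀ (hg01 _).2 h1.1 h1.2)
        _ ≤ 1 := by
            rw [sum_vacancy_sub]
            linarith [vacancy_nonneg D h 0 j]

namespace IsSparseConfiguration

variable {D : Set ℝ} {g : ℝ → ℝ} {a b t : ℝ}

/-- Points accumulate at 0, so cell 0 is always occupied and a last occupied cell exists. -/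
theorem vacancy_zero (hD : IsSparseConfiguration D) {h : ℝ} (hh : 0 < h) {j : ℕ} (hj : 0 < j) :
    vacancy D h 0 j = 0 := by
  have hj' : (0 : ℝ) < j := by exact_mod_cast hj
  obtain ⟨u, hu, hlt⟩ := hD.exists_lt (j * h) (by positivity)
  refine if_neg fun he => ?_
  have : u ∈ D ∩ Ico ((0 : ℕ) * h) (j * h) := ⟨hu, by simpa using (hD.pos u hu).le, hlt⟩
  rw [he] at this
  exact this

theorem gridProd_eq_one (hD : IsSparseConfiguration D) (hg1 : ∀ x, x ∉ Ioo a b → g x = 1)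
    {h : ℝ} (hh : 0 < h) (j : ℕ) (hj : j * h ≤ a) : gridProd g D h j = 1 := by
  induction j using Nat.strong_induction_on with
  | _ j ih =>
    rcases Nat.eq_zero_or_pos j with rfl | hj0
    · simp [gridProd]
    rw [gridProd_of_pos g D h hj0]
    trans ∑ i ∈ Finset.range j, (vacancy D h (i + 1) j - vacancy D h i j)
    · refine Finset.sum_congr rfl fun i hi => ?_
      have hij : (i : ℝ) ≤ j := by exact_mod_cast (Finset.mem_range.1 hi).le
      have hle : (i : ℝ) * h ≤ j * h := by gcongr
      have hi0 : 0 ≤ (i : ℝ) * h := by positivity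
      rw [ih i (Finset.mem_range.1 hi) (hle.trans hj), hg1 _ fun hx => ?_, mul_one, mul_one]
      have := hx.1
      nlinarith
    · rw [sum_vacancy_sub, hD.vacancy_zero hh hj0, sub_zero]

end IsSparseConfiguration

theorem gridProd_eq_of_vacancy (g : ℝ → ℝ) (D : Set ℝ) {h : ℝ} (hh : 0 ≤ h) {i j : ℕ} (hij : i < j)
    (h1 : vacancy D h (i + 1) j = 1) (h0 : vacancy D h i j = 0) :
    gridProd g D h j = g ((j - i) * h) * gridProd g D h i := by
  rw [gridProd_of_pos g D h (Nat.zero_lt_of_lt hij),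
    Finset.sum_eq_single_of_mem i (Finset.mem_range.2 hij), h1, h0, sub_zero, one_mul]
  intro l _ hl
  rcases lt_or_gt_of_ne hl with hlt | hgt
  · have e : ∀ m ≤ i, vacancy D h m j = 0 := fun m hm =>
      le_antisymm (h0 ▸ vacancy_mono D hh hm j) (vacancy_nonneg _ _ _ _)
    rw [e l hlt.le, e (l + 1) hlt]
    simp
  · have e : ∀ m, i + 1 ≤ m → vacancy D h m j = 1 := fun m hm =>
      le_antisymm (vacancy_le_one _ _ _ _) (h1 ▸ vacancy_mono D hh hm j)
    rw [e l hgt, e (l + 1) (by omega)]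
    simp

theorem tendsto_floor_div_mul {t : ℝ} (ht : 0 ≤ t) :
    Tendsto (fun h : ℝ => (⌊t / h⌋₊ : ℝ) * h) (𝓝[>] 0) (𝓝 t) := by
  have h1 : Tendsto (fun h : ℝ => t - h) (𝓝[>] 0) (𝓝 t) := by
    have : Continuous fun h : ℝ => t - h := by fun_prop
    simpa using (this.tendsto 0).mono_left nhdsWithin_le_nhds
  refine tendsto_of_tendsto_of_tendsto_of_le_of_le' h1 tendsto_const_nhds ?_ ?_
  · filter_upwards [self_mem_nhdsWithin] with h hh
    have hh' : (0 : ℝ) < h := hh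
    have := Nat.lt_floor_add_one (t / h)
    rw [div_lt_iff₀ hh'] at this
    linarith
  · filter_upwards [self_mem_nhdsWithin] with h hh
    have hh' : (0 : ℝ) < h := hh
    have := Nat.floor_le (div_nonneg ht hh'.le)
    rwa [le_div_iff₀ hh'] at this

/-- Once `h` is small, `gridProd` obeys the same one-step recursion through the last point `p` as
`spacingProdBefore`, up to rounding errors that continuity of `g` absorbs. Induction is on the
number of points in `[a, t)`; up to `a` both products are 1. -/
theorem IsSparseConfiguration.tendsto_gridProd {D : Set ℝ} {g : ℝ → ℝ} {a b : ℝ}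
    (hD : IsSparseConfiguration D) (ha : 0 < a)
    (hg : Continuous g) (hg1 : ∀ x, x ∉ Ioo a b → g x = 1) {t : ℝ} (ht : 0 < t) :
    Tendsto (fun h => gridProd g D h ⌊t / h⌋₊) (𝓝[>] 0) (𝓝 (spacingProdBefore g D t)) := by
  induction hn : (D ∩ Ico a t).ncard using Nat.strong_induction_on generalizing t with
  | _ n ih =>
    have base : ∀ t, 0 < t → t ≤ a →
        Tendsto (fun h => gridProd g D h ⌊t / h⌋₊) (𝓝[>] 0) (𝓝 (spacingProdBefore g D t)) := by
      intro t ht hta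
      rw [hD.spacingProdBefore_of_le hg1 ht hta]
      refine tendsto_const_nhds.congr' ?_
      filter_upwards [self_mem_nhdsWithin] with h hh
      have hh' : (0 : ℝ) < h := hh
      refine (hD.gridProd_eq_one hg1 hh' _ ?_).symm
      refine le_trans ?_ hta
      have := Nat.floor_le (div_nonneg ht.le hh'.le)
      rwa [le_div_iff₀ hh'] at this
    set p := lastBefore D t with hp
    have hpD : p ∈ D := hD.lastBefore_mem ht
    have hpt : p < t := hD.lastBefore_lt ht
    have hp0 : 0 < p := hD.pos p hpD
    have hstep : Tendsto (fun h => gridProd g D h ⌊p / h⌋₊) (𝓝[>] 0)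
        (𝓝 (spacingProdBefore g D p)) := by
      rcases lt_or_ge p a with hpa | hpa
      · exact base p hp0 hpa.le
      · refine ih _ ?_ hp0 rfl
        rw [← hn]
        refine ncard_lt_ncard ?_ ((hD.finite a t ha).subset
          (inter_subset_inter_right _ Ico_subset_Icc_self))
        refine ⟨inter_subset_inter_right _ (Ico_subset_Ico_right hpt.le), fun hsub => ?_⟩
        exact lt_irrefl p (hsub ⟨hpD, hpa, hpt⟩).2.2
    rw [hD.spacingProdBefore_eq ha hg1 ht, ← hp]
    have hg' : Tendsto (fun h : ℝ => g (((⌊t / h⌋₊ : ℝ) - ⌊p / h⌋₊) * h)) (𝓝[>] 0)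
        (𝓝 (g (t - p))) := by
      refine (hg.tendsto _).comp ?_
      simp only [sub_mul]
      exact (tendsto_floor_div_mul ht.le).sub (tendsto_floor_div_mul hp0.le)
    refine (hg'.mul hstep).congr' ?_
    -- For `h < t - p` the cell of `p` lies strictly before the cell of `t`, and is the last
    -- occupied one.
    filter_upwards [Ioo_mem_nhdsGT (sub_pos.2 hpt)] with h hh
    have hh0 : 0 < h := hh.1
    have f1 := Nat.floor_le (div_nonneg ht.le hh0.le)
    have f2 := Nat.floor_le (div_nonneg hp0.le hh0.le)
    have f3 := Nat.lt_floor_add_one (p / h)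
    rw [le_div_iff₀ hh0] at f1 f2
    rw [div_lt_iff₀ hh0] at f3
    have hlt : ⌊p / h⌋₊ < ⌊t / h⌋₊ := by
      rw [Nat.lt_iff_add_one_le, Nat.le_floor_iff (by positivity), le_div_iff₀ hh0]
      push_cast
      linarith [hh.2]
    refine (gridProd_eq_of_vacancy g D hh0.le hlt (if_pos ?_) (if_neg ?_)).symm
    · rw [eq_empty_iff_forall_notMem]
      rintro u ⟨hu, hu1, hu2⟩
      have := hD.le_lastBefore hu (hu2.trans_le f1)
      push_cast at hu1
      linarith
    · intro he
      have : p ∈ D ∩ Ico (⌊p / h⌋₊ * h) (⌊t / h⌋₊ * h) := by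
        refine ⟨hpD, f2, f3.trans_le ?_⟩
        have : ((⌊p / h⌋₊ : ℝ) + 1) ≤ ⌊t / h⌋₊ := by exact_mod_cast hlt
        gcongr
      rw [he] at this
      exact this

/-! ### The intensity `k / t` -/

section Intensity

variable {k a b : ℝ}

theorem selfSimilarIntensity_Ico (hk : 0 < k) (ha : 0 < a) (hab : a ≤ b) :
    selfSimilarIntensity k (Ico a b) = ENNReal.ofReal (k * Real.log (b / a)) := by
  have hsub : Ico a b ⊆ Ioi 0 := fun x hx => ha.trans_le hx.1
  rw [selfSimilarIntensity, withDensity_apply _ measurableSet_Ico,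
    Measure.restrict_restrict measurableSet_Ico, inter_eq_left.2 hsub,
    ← integral_inv_of_pos ha (ha.trans_le hab), ← intervalIntegral.integral_const_mul,
    intervalIntegral.integral_of_le hab, integral_Ioc_eq_integral_Ioo,
    ← integral_Ico_eq_integral_Ioo, ofReal_integral_eq_lintegral_ofReal]
  · simp only [div_eq_mul_inv]
  · have : ContinuousOn (fun x : ℝ => k * x⁻¹) (Icc a b) :=
      continuousOn_const.mul (continuousOn_inv₀.mono fun x hx => (ha.trans_le hx.1).ne')
    exact (this.integrableOn_Icc).mono_set Ico_subset_Icc_self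
  · filter_upwards [ae_restrict_mem measurableSet_Ico] with x hx
    have := ha.trans_le hx.1
    simp only [Pi.zero_apply]
    positivity

theorem toReal_selfSimilarIntensity_Ico (hk : 0 < k) (ha : 0 < a) (hab : a ≤ b) :
    (selfSimilarIntensity k (Ico a b)).toReal = k * Real.log (b / a) := by
  rw [selfSimilarIntensity_Ico hk ha hab, ENNReal.toReal_ofReal]
  exact mul_nonneg hk.le (Real.log_nonneg ((one_le_div ha).2 hab))

theorem mul_log_div_le (hk : 0 < k) (ha : 0 < a) (hab : a ≤ b) :
    k * Real.log (b / a) ≤ k * (b - a) / a := by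
  have := Real.log_le_sub_one_of_pos (div_pos (ha.trans_le hab) ha)
  rw [mul_div_assoc]
  gcongr
  refine this.trans_eq ?_
  field_simp

theorem selfSimilarIntensity_ne_top_of_subset (hk : 0 < k) (ha : 0 < a) {A : Set ℝ}
    (hA : A ⊆ Icc a b) : selfSimilarIntensity k A ≠ ∞ := by
  rcases le_or_gt a b with hab | hab
  · have hsub : A ⊆ Ico a (b + 1) := fun x hx => ⟨(hA hx).1, by linarith [(hA hx).2]⟩
    refine ne_top_of_le_ne_top ?_ (measure_mono hsub)
    rw [selfSimilarIntensity_Ico hk ha (by linarith)]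
    exact ENNReal.ofReal_ne_top
  · rw [Icc_eq_empty (not_le.2 hab)] at hA
    simp [subset_empty_iff.1 hA]

theorem selfSimilarIntensity_Iic_zero : selfSimilarIntensity k (Iic 0) = 0 := by
  rw [selfSimilarIntensity, withDensity_apply _ measurableSet_Iic,
    Measure.restrict_restrict measurableSet_Iic, Iic_inter_Ioi, Ioc_self, Measure.restrict_empty,
    lintegral_zero_measure]

theorem selfSimilarIntensity_Ioo_zero (hk : 0 < k) (hb : 0 < b) :
    selfSimilarIntensity k (Ioo 0 b) = ∞ := by
  refine ENNReal.eq_top_of_forall_nnreal_le fun r => ?_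
  have h1 : 1 ≤ Real.exp (r / k) := Real.one_le_exp (by positivity)
  have hpos : 0 < b / Real.exp (r / k) := by positivity
  calc (r : ℝ≥0∞) = selfSimilarIntensity k (Ico (b / Real.exp (r / k)) b) := by
        rw [selfSimilarIntensity_Ico hk hpos (div_le_self hb.le h1), div_div_cancel₀ hb.ne',
          Real.log_exp, mul_div_cancel₀ _ hk.ne']
        simp
    _ ≤ selfSimilarIntensity k (Ioo 0 b) :=
        measure_mono fun x (hx : x ∈ Ico _ _) => ⟨hpos.trans_le hx.1, hx.2⟩

theorem integral_selfSimilarIntensity (hk : 0 < k) (f : ℝ → ℝ) :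
    ∫ x, f x ∂selfSimilarIntensity k = ∫ x in Ioi 0, f x * (k / x) := by
  rw [selfSimilarIntensity, integral_withDensity_eq_integral_toReal_smul (by fun_prop) (by simp)]
  refine setIntegral_congr_fun measurableSet_Ioi fun x hx => ?_
  have hx' : (0 : ℝ) < x := hx
  simp only [smul_eq_mul]
  rw [ENNReal.toReal_ofReal (by positivity), mul_comm]

end Intensity

/-! ### Counting measures and general Poisson processes -/

theorem pointMeasure_apply {E : Type*} [MeasurableSpace E] (S : Set E) {A : Set E}
    (hA : MeasurableSet A) : pointMeasure S A = Measure.count (S ∩ A) := by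
  rw [pointMeasure, Measure.restrict_apply hA, inter_comm]

theorem pointMeasure_eq_zero_iff {E : Type*} [MeasurableSpace E] {S A : Set E}
    (hA : MeasurableSet A) : pointMeasure S A = 0 ↔ S ∩ A = ∅ := by
  rw [pointMeasure_apply S hA, Measure.count_eq_zero_iff]

theorem pointMeasure_lt_top_iff {E : Type*} [MeasurableSpace E] [MeasurableSingletonClass E]
    {S A : Set E} (hA : MeasurableSet A) : pointMeasure S A < ∞ ↔ (S ∩ A).Finite := by
  rw [pointMeasure_apply S hA, Measure.count_apply_lt_top]

theorem two_le_pointMeasure {E : Type*} [MeasurableSpace E] [MeasurableSingletonClass E]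
    {S A : Set E} (hA : MeasurableSet A) {x y : E} (hx : x ∈ S ∩ A) (hy : y ∈ S ∩ A)
    (hxy : x ≠ y) : 2 ≤ pointMeasure S A := by
  rw [pointMeasure_apply S hA]
  classical
  calc (2 : ℝ≥0∞) = Measure.count (({x, y} : Finset E) : Set E) := by
        rw [Measure.count_apply_finset, Finset.card_pair hxy]; simp
    _ ≤ _ := measure_mono (by
        intro z hz
        simp only [Finset.coe_insert, Finset.coe_singleton, mem_insert_iff,
          mem_singleton_iff] at hz
        rcases hz with rfl | rfl <;> assumption)

namespace IsPoissonProcess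

variable {Ω E : Type*} [MeasurableSpace Ω] [MeasurableSpace E] {T : Ω → Set E} {Λ : Measure E}
  {P : Measure Ω} {A : Set E}

theorem measurable_apply (hT : IsPoissonProcess T Λ P) (hA : MeasurableSet A) :
    Measurable fun ω => pointMeasure (T ω) A :=
  (Measure.measurable_coe hA).comp hT.measurable

theorem integral_comp (hT : IsPoissonProcess T Λ P) (hA : MeasurableSet A)
    (hΛ : Λ A ≠ ∞) {f : ℝ≥0∞ → ℝ} (hf : Measurable f) :
    ∫ ω, f (pointMeasure (T ω) A) ∂P =
      ∑' n : ℕ, Real.exp (-(Λ A).toReal) * (Λ A).toReal ^ n / n.factorial * f n := by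
  have h1 := (hT.law A hA hΛ).integral_comp (f := f) hf.aestronglyMeasurable
  rw [integral_map (by fun_prop) hf.aestronglyMeasurable, integral_poissonMeasure] at h1
  exact h1

theorem measureReal_mem (hT : IsPoissonProcess T Λ P) (hA : MeasurableSet A)
    (hΛ : Λ A ≠ ∞) {p : ℝ≥0∞ → Prop} (hp : MeasurableSet {x | p x}) :
    P.real {ω | p (pointMeasure (T ω) A)} =
      (poissonMeasure (Λ A).toNNReal).real {n | p n} := by
  rw [(hT.law A hA hΛ).measureReal_eq hp, map_measureReal_apply (by fun_prop) hp]
  rfl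

theorem measureReal_empty (hT : IsPoissonProcess T Λ P) (hA : MeasurableSet A) (hΛ : Λ A ≠ ∞) :
    P.real {ω | T ω ∩ A = ∅} = Real.exp (-(Λ A).toReal) := by
  have h1 := hT.measureReal_mem hA hΛ (p := fun x => x = 0) (measurableSet_singleton 0)
  simp only [pointMeasure_eq_zero_iff hA] at h1
  rw [h1]
  have : {n : ℕ | (n : ℝ≥0∞) = 0} = {0} := by ext; simp
  rw [this, poissonMeasure_real_singleton]
  simp [ENNReal.coe_toNNReal_eq_toReal]

theorem measurableSet_empty (hT : IsPoissonProcess T Λ P) (hA : MeasurableSet A) :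
    MeasurableSet {ω | T ω ∩ A = ∅} := by
  simp only [← pointMeasure_eq_zero_iff hA]
  exact hT.measurable_apply hA (measurableSet_singleton 0)

theorem ae_ne_top (hT : IsPoissonProcess T Λ P) (hA : MeasurableSet A) (hΛ : Λ A ≠ ∞) :
    ∀ᵐ ω ∂P, pointMeasure (T ω) A < ∞ := by
  rw [(hT.law A hA hΛ).ae_iff (p := fun x => x < ∞) (by fun_prop)]
  rw [ae_map_iff (by fun_prop) measurableSet_Iio]
  exact Eventually.of_forall fun n => ENNReal.natCast_lt_top n

theorem measureReal_two_le (hT : IsPoissonProcess T Λ P) (hA : MeasurableSet A) (hΛ : Λ A ≠ ∞) :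
    P.real {ω | 2 ≤ pointMeasure (T ω) A} ≤ (Λ A).toReal ^ 2 := by
  rw [hT.measureReal_mem hA hΛ (p := fun x => 2 ≤ x) measurableSet_Ici]
  have : {n : ℕ | (2 : ℝ≥0∞) ≤ n} = ({0} ∪ {1})ᶜ := by
    ext n
    simp only [mem_ofPred_eq, mem_compl_iff, mem_union, mem_singleton_iff, Nat.ofNat_le_cast]
    omega
  rw [this, probReal_compl_eq_one_sub (by measurability), measureReal_union (by simp) (by simp),
    poissonMeasure_real_singleton, poissonMeasure_real_singleton, ENNReal.coe_toNNReal_eq_toReal]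
  -- With `λ` the mass of `A`, the probability is `1 - (1 + λ) e^(-λ)`, and `e^(-λ) ≥ 1 - λ` bounds
  -- it by `λ²`.
  have h1 := Real.one_sub_le_exp_neg (Λ A).toReal
  have h0 : 0 ≤ (Λ A).toReal := ENNReal.toReal_nonneg
  simp only [pow_zero, pow_one, Nat.factorial]
  norm_num
  nlinarith

theorem measure_two_le [IsProbabilityMeasure P] (hT : IsPoissonProcess T Λ P)
    (hA : MeasurableSet A) (hΛ : Λ A ≠ ∞) :
    P {ω | 2 ≤ pointMeasure (T ω) A} ≤ ENNReal.ofReal ((Λ A).toReal ^ 2) := by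
  rw [← ofReal_measureReal (μ := P)]
  exact ENNReal.ofReal_le_ofReal (hT.measureReal_two_le hA hΛ)

theorem measure_nonempty_le [IsProbabilityMeasure P] (hT : IsPoissonProcess T Λ P)
    (hA : MeasurableSet A) (hΛ : Λ A ≠ ∞) : P {ω | T ω ∩ A ≠ ∅} ≤ ENNReal.ofReal (Λ A).toReal := by
  have : {ω | T ω ∩ A ≠ ∅} = {ω | T ω ∩ A = ∅}ᶜ := rfl
  rw [← ofReal_measureReal (μ := P), this, probReal_compl_eq_one_sub (hT.measurableSet_empty hA),
    hT.measureReal_empty hA hΛ]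
  exact ENNReal.ofReal_le_ofReal (by linarith [Real.one_sub_le_exp_neg (Λ A).toReal])

theorem integral_exp_neg_mul (hT : IsPoissonProcess T Λ P) (hA : MeasurableSet A)
    (hΛ : Λ A ≠ ∞) (c : ℝ) :
    ∫ ω, Real.exp (-(c * (pointMeasure (T ω) A).toReal)) ∂P =
      Real.exp (-((1 - Real.exp (-c)) * (Λ A).toReal)) := by
  rw [hT.integral_comp hA hΛ (f := fun x => Real.exp (-(c * x.toReal))) (by fun_prop)]
  set r := (Λ A).toReal
  have h1 := (NormedSpace.expSeries_div_hasSum_exp (r * Real.exp (-c))).mul_left (Real.exp (-r))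
  rw [← Real.exp_eq_exp_ℝ, ← Real.exp_add] at h1
  convert! h1.tsum_eq using 2
  · ext n
    rw [ENNReal.toReal_natCast, mul_pow, ← Real.exp_nat_mul,
      show -(c * (n : ℝ)) = n * -c by ring]
    ring
  · ring

/-- The Laplace functional of a Poisson process on bounded integer-valued functions. -/
theorem integral_exp_neg_lintegral (hT : IsPoissonProcess T Λ P) {f : E → ℕ} (hf : Measurable f)
    {K : ℕ} (hK : ∀ x, f x ≤ K) (hΛ : Λ {x | f x ≠ 0} ≠ ∞) :
    ∫ ω, Real.exp (-(∫⁻ x, (f x : ℝ≥0∞) ∂pointMeasure (T ω)).toReal) ∂P =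
      Real.exp (-∫ x, (1 - Real.exp (-(f x : ℝ))) ∂Λ) := by
  classical
  -- Index `c` stands for the value `c + 1`; the value 0 is left out, since its level set may have
  -- infinite mass.
  set A : Fin K → Set E := fun c => f ⁻¹' {(c : ℕ) + 1} with hAdef
  have hA : ∀ c, MeasurableSet (A c) := fun c => hf (measurableSet_singleton _)
  have hAΛ : ∀ c, Λ (A c) ≠ ∞ := fun c => by
    refine ne_top_of_le_ne_top hΛ (measure_mono fun x hx => ?_)
    have : f x = c + 1 := hx
    simp [this]
  have hdisj : Pairwise fun i j => Disjoint (A i) (A j) := fun i j hij => by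
    refine Set.disjoint_left.2 fun x hi hj => hij (Fin.ext ?_)
    have h1 : f x = i + 1 := hi
    have h2 : f x = j + 1 := hj
    omega
  have hdecomp : ∀ {R : Type} [NonAssocSemiring R] (u : ℕ → R), u 0 = 0 → ∀ x,
      u (f x) = ∑ c : Fin K, u (c + 1) * (A c).indicator (fun _ => (1 : R)) x := by
    intro R _ u hu x
    rcases Nat.eq_zero_or_pos (f x) with h0 | hpos
    · rw [h0, hu]
      refine (Finset.sum_eq_zero fun c _ => ?_).symm
      rw [indicator_of_notMem, mul_zero]
      intro hx
      have : f x = c + 1 := hx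
      omega
    · rw [Finset.sum_eq_single_of_mem (⟨f x - 1, by have := hK x; omega⟩ : Fin K)
        (Finset.mem_univ _)]
      · have hx : f x - 1 + 1 = f x := by omega
        rw [indicator_of_mem (by simp [hAdef, hx]), mul_one]
        simp only [hx]
      · intro c _ hc
        rw [indicator_of_notMem, mul_zero]
        intro hx
        have : f x = c + 1 := hx
        exact hc (Fin.ext (by simp [this]))
  have hlint : ∀ μ : Measure E,
      ∫⁻ x, (f x : ℝ≥0∞) ∂μ = ∑ c : Fin K, ((c : ℕ) + 1 : ℕ) * μ (A c) := by
    intro μ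
    simp_rw [hdecomp (fun n : ℕ => (n : ℝ≥0∞)) (by simp)]
    rw [lintegral_finsetSum _ fun c _ => (measurable_const.indicator (hA c)).const_mul _]
    refine Finset.sum_congr rfl fun c _ => ?_
    rw [lintegral_const_mul _ (measurable_const.indicator (hA c)), lintegral_indicator (hA c)]
    simp
  have hint : ∫ x, (1 - Real.exp (-(f x : ℝ))) ∂Λ =
      ∑ c : Fin K, (1 - Real.exp (-((c : ℕ) + 1 : ℕ))) * (Λ (A c)).toReal := by
    simp_rw [hdecomp (fun n : ℕ => 1 - Real.exp (-(n : ℝ))) (by simp)]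
    have hi : ∀ c, Integrable ((A c).indicator fun _ => (1 : ℝ)) Λ := fun c =>
      (integrable_indicator_iff (hA c)).2 (integrableOn_const (hAΛ c))
    rw [integral_finsetSum _ fun c _ => (hi c).const_mul _]
    refine Finset.sum_congr rfl fun c _ => ?_
    rw [integral_const_mul, integral_indicator_const _ (hA c)]
    simp [measureReal_def]
  have hae : ∀ᵐ ω ∂P, ∀ c, pointMeasure (T ω) (A c) < ∞ :=
    ae_all_iff.2 fun c => hT.ae_ne_top (hA c) (hAΛ c)
  have h1 : (fun ω => Real.exp (-(∫⁻ x, (f x : ℝ≥0∞) ∂pointMeasure (T ω)).toReal)) =ᵐ[P]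
      fun ω => ∏ c : Fin K,
        Real.exp (-(((c : ℕ) + 1 : ℕ) * (pointMeasure (T ω) (A c)).toReal)) := by
    filter_upwards [hae] with ω hω
    rw [hlint, ENNReal.toReal_sum fun c _ => ENNReal.mul_ne_top (by simp) (hω c).ne,
      ← Real.exp_sum, ← Finset.sum_neg_distrib]
    simp only [ENNReal.toReal_mul, ENNReal.toReal_natCast]
  rw [integral_congr_ae h1, (hT.indep K A hA hdisj).integral_fun_prod_comp
    (f := fun (c : Fin K) x => Real.exp (-(((c : ℕ) + 1 : ℕ) * x.toReal)))
    (fun c => (hT.measurable_apply (hA c)).aemeasurable)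
    (fun c => Measurable.aestronglyMeasurable (by fun_prop)), hint, ← Finset.sum_neg_distrib,
    Real.exp_sum]
  exact Finset.prod_congr rfl fun c _ => hT.integral_exp_neg_mul (hA c) (hAΛ c) _

end IsPoissonProcess

/-! ### Almost sure path properties -/

section SelfSimilar

variable {Ω : Type*} [MeasurableSpace Ω] {P : Measure Ω} [IsProbabilityMeasure P] {k : ℝ}
  {T : Ω → Set ℝ}

/-- Sparseness is Borel–Cantelli: a window `[(j+1)L, (j+3)L)` has mass at most `2k / (j+1)`, hence
contains two points with probability at most the square of this, which is summable. The windows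
overlap, so that two far points closer than `L` share one. -/
theorem ae_isSparseConfiguration (hk : 0 < k)
    (hT : IsPoissonProcess T (selfSimilarIntensity k) P) :
    ∀ᵐ ω ∂P, IsSparseConfiguration (T ω) := by
  have h1 : ∀ᵐ ω ∂P, T ω ∩ Iic 0 = ∅ := by
    have := hT.measure_nonempty_le measurableSet_Iic
      (by rw [selfSimilarIntensity_Iic_zero]; simp)
    rw [selfSimilarIntensity_Iic_zero] at this
    simpa [ae_iff] using this
  have h2 : ∀ᵐ ω ∂P, ∀ n : ℕ, (T ω ∩ Icc (1 / ((n : ℝ) + 1)) n).Finite := by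
    refine ae_all_iff.2 fun n => ?_
    filter_upwards [hT.ae_ne_top (A := Icc (1 / ((n : ℝ) + 1)) n) measurableSet_Icc
      (selfSimilarIntensity_ne_top_of_subset hk (by positivity) subset_rfl)] with ω hω
    exact (pointMeasure_lt_top_iff measurableSet_Icc).1 hω
  have h3 : ∀ᵐ ω ∂P, ∀ n : ℕ, (T ω ∩ Ioo 0 (1 / ((n : ℝ) + 1))).Nonempty := by
    refine ae_all_iff.2 fun n => ?_
    filter_upwards [hT.infinite (Ioo 0 (1 / ((n : ℝ) + 1))) measurableSet_Ioo
      (selfSimilarIntensity_Ioo_zero hk (by positivity))] with ω hω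
    rw [nonempty_iff_ne_empty, ne_eq, ← pointMeasure_eq_zero_iff measurableSet_Ioo, hω]
    simp
  have h4 : ∀ᵐ ω ∂P, ∀ m : ℕ, ∀ᶠ j : ℕ in atTop,
      ¬ 2 ≤ pointMeasure (T ω) (Ico (((j : ℝ) + 1) * (m + 1)) (((j : ℝ) + 3) * (m + 1))) := by
    refine ae_all_iff.2 fun m => ?_
    refine ae_eventually_notMem (μ := P) (s := fun j : ℕ => {ω | 2 ≤ pointMeasure (T ω)
      (Ico (((j : ℝ) + 1) * (m + 1)) (((j : ℝ) + 3) * (m + 1)))}) ?_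
    have hs : Summable fun j : ℕ => (2 * k) ^ 2 * (1 / ((j + 1 : ℕ) : ℝ) ^ 2) :=
      ((summable_nat_add_iff 1).2 (Real.summable_one_div_nat_pow.2 one_lt_two)).mul_left _
    refine ne_top_of_le_ne_top hs.tsum_ofReal_ne_top (ENNReal.tsum_le_tsum fun j => ?_)
    have hpos : 0 < ((j : ℝ) + 1) * (m + 1) := by positivity
    have hle : ((j : ℝ) + 1) * (m + 1) ≤ ((j : ℝ) + 3) * (m + 1) := by gcongr; norm_num
    refine (hT.measure_two_le measurableSet_Ico
      (selfSimilarIntensity_ne_top_of_subset hk hpos Ico_subset_Icc_self)).trans ?_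
    refine ENNReal.ofReal_le_ofReal ?_
    rw [toReal_selfSimilarIntensity_Ico hk hpos hle]
    have h0 : 0 ≤ k * Real.log (((j : ℝ) + 3) * (m + 1) / (((j : ℝ) + 1) * (m + 1))) :=
      mul_nonneg hk.le (Real.log_nonneg ((one_le_div hpos).2 hle))
    calc _ ≤ (2 * k / (j + 1)) ^ 2 := by
          refine pow_le_pow_left₀ h0 ((mul_log_div_le hk hpos hle).trans_eq ?_) 2
          field_simp
          ring
      _ = _ := by push_cast; field_simp
  filter_upwards [h1, h2, h3, h4] with ω h1 h2 h3 h4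
  refine ⟨fun t ht => ?_, fun a b ha => ?_, fun ε hε => ?_, fun b hb => ?_⟩
  · by_contra! h
    have : t ∈ T ω ∩ Iic 0 := ⟨ht, h⟩
    rw [h1] at this
    exact this
  · obtain ⟨n, hn⟩ := exists_nat_one_div_lt ha
    obtain ⟨m, hm⟩ := exists_nat_ge b
    refine (h2 (max n m)).subset (inter_subset_inter_right _ (Icc_subset_Icc ?_ ?_))
    · refine le_trans ?_ hn.le
      gcongr
      exact_mod_cast le_max_left n m
    · exact hm.trans (by exact_mod_cast le_max_right n m)
  · obtain ⟨n, hn⟩ := exists_nat_one_div_lt hε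
    obtain ⟨t, ht, ht'⟩ := h3 n
    exact ⟨t, ht, ht'.2.trans hn⟩
  · obtain ⟨m, hm⟩ := exists_nat_ge b
    obtain ⟨J, hJ⟩ := eventually_atTop.1 (h4 m)
    refine ⟨((J : ℝ) + 2) * (m + 1), fun s hs t ht hMt hst => ?_⟩
    by_contra! hlt
    have hm0 : (0 : ℝ) < m + 1 := by positivity
    have ht0 : 0 ≤ t / (m + 1) := by
      refine div_nonneg (le_trans (by positivity) hMt) hm0.le
    have f1 := Nat.floor_le ht0
    have f2 := Nat.lt_floor_add_one (t / (m + 1))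
    have f3 : J + 2 ≤ ⌊t / ((m : ℝ) + 1)⌋₊ := by
      rw [Nat.le_floor_iff ht0, le_div_iff₀ hm0]
      exact_mod_cast hMt
    -- With `L = m + 1`, `t` lies in `[(j+2)L, (j+3)L)`; since `t - s < b < L`, `s` is in the `j`-th
    -- window too.
    obtain ⟨j, hj⟩ := Nat.exists_eq_add_of_le' (show 2 ≤ ⌊t / ((m : ℝ) + 1)⌋₊ by omega)
    rw [hj] at f1 f2 f3
    rw [le_div_iff₀ hm0] at f1
    rw [div_lt_iff₀ hm0] at f2
    push_cast at f1 f2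
    refine hJ j (by omega) (two_le_pointMeasure measurableSet_Ico (x := s) (y := t)
      ⟨hs, ?_, ?_⟩ ⟨ht, ?_, ?_⟩ hst.ne)
    all_goals nlinarith

theorem measure_inter_Ico_ne_empty_le (hk : 0 < k)
    (hT : IsPoissonProcess T (selfSimilarIntensity k) P) {b t : ℝ} (hb : 0 < b) (ht : b < t) :
    P {ω | T ω ∩ Ico (t - b) t ≠ ∅} ≤ ENNReal.ofReal (k * b / (t - b)) := by
  refine (hT.measure_nonempty_le measurableSet_Ico (selfSimilarIntensity_ne_top_of_subset hk
    (sub_pos.2 ht) Ico_subset_Icc_self)).trans (ENNReal.ofReal_le_ofReal ?_)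
  rw [toReal_selfSimilarIntensity_Ico hk (sub_pos.2 ht) (by linarith)]
  refine (mul_log_div_le hk (sub_pos.2 ht) (by linarith)).trans_eq ?_
  ring

end SelfSimilar

/-! ### Information carried by grid cells -/

theorem inter_Ico_grid_eq_empty_iff (D : Set ℝ) {h : ℝ} (hh : 0 < h) (i j : ℕ) :
    D ∩ Ico (i * h) (j * h) = ∅ ↔
      ∀ l ∈ Finset.Ico i j, D ∩ Ico (l * h) ((l + 1 : ℕ) * h) = ∅ := by
  constructor
  · intro he l hl
    rw [Finset.mem_Ico] at hl
    refine subset_empty_iff.1 (he ▸ inter_subset_inter_right _ (Ico_subset_Ico ?_ ?_))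
    · have : (i : ℝ) ≤ l := by exact_mod_cast hl.1
      gcongr
    · have : ((l + 1 : ℕ) : ℝ) ≤ j := by exact_mod_cast hl.2
      gcongr
  · intro hl
    rw [eq_empty_iff_forall_notMem]
    rintro u ⟨hu, h1, h2⟩
    have hu0 : 0 ≤ u / h := div_nonneg (le_trans (by positivity) h1) hh.le
    have f1 := Nat.floor_le hu0
    have f2 := Nat.lt_floor_add_one (u / h)
    have f3 : i ≤ ⌊u / h⌋₊ := by rwa [Nat.le_floor_iff hu0, le_div_iff₀ hh]
    have f4 : ⌊u / h⌋₊ < j := by rwa [Nat.floor_lt hu0, div_lt_iff₀ hh]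
    rw [le_div_iff₀ hh] at f1
    rw [div_lt_iff₀ hh] at f2
    have : u ∈ D ∩ Ico (⌊u / h⌋₊ * h) ((⌊u / h⌋₊ + 1 : ℕ) * h) :=
      ⟨hu, f1, by push_cast; exact f2⟩
    rw [hl _ (Finset.mem_Ico.2 ⟨f3, f4⟩)] at this
    exact this

/-- The information on `T` contained in the numbers of points in the grid cells with index in
`S`. -/
@[reducible]
noncomputable def gridSigma {Ω : Type*} (T : Ω → Set ℝ) (h : ℝ) (S : Set ℕ) : MeasurableSpace Ω :=
  ⨆ l ∈ S, MeasurableSpace.comap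
    (fun ω => pointMeasure (T ω) (Ico ((l : ℝ) * h) ((l + 1 : ℕ) * h))) inferInstance

theorem gridSigma_mono {Ω : Type*} (T : Ω → Set ℝ) (h : ℝ) {S S' : Set ℕ} (hS : S ⊆ S') :
    gridSigma T h S ≤ gridSigma T h S' :=
  biSup_mono hS

theorem measurable_vacancy_gridSigma {Ω : Type*} (T : Ω → Set ℝ) {h : ℝ} (hh : 0 < h) {S : Set ℕ}
    {i j : ℕ} (hS : Ico i j ⊆ S) :
    Measurable[gridSigma T h S] fun ω => vacancy (T ω) h i j := by
  let _ := gridSigma T h S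
  refine Measurable.ite ?_ measurable_const measurable_const
  have : {ω | T ω ∩ Ico ((i : ℝ) * h) (j * h) = ∅} = ⋂ l ∈ Finset.Ico i j,
      (fun ω => pointMeasure (T ω) (Ico ((l : ℝ) * h) ((l + 1 : ℕ) * h))) ⁻¹' {0} := by
    ext ω
    rw [mem_ofPred_eq, inter_Ico_grid_eq_empty_iff _ hh]
    simp only [mem_iInter, mem_preimage, mem_singleton_iff,
      pointMeasure_eq_zero_iff measurableSet_Ico]
  rw [this]
  refine Finset.measurableSet_biInter _ fun l hl => ?_
  have hle : MeasurableSpace.comap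
    (fun ω => pointMeasure (T ω) (Ico ((l : ℝ) * h) ((l + 1 : ℕ) * h))) inferInstance ≤
      gridSigma T h S := le_biSup (fun l : ℕ => MeasurableSpace.comap
    (fun ω => pointMeasure (T ω) (Ico ((l : ℝ) * h) ((l + 1 : ℕ) * h))) inferInstance)
      (hS (Finset.mem_Ico.1 hl))
  exact hle _ ⟨{0}, measurableSet_singleton 0, rfl⟩

theorem measurable_gridProd_gridSigma {Ω : Type*} (g : ℝ → ℝ) (T : Ω → Set ℝ) {h : ℝ} (hh : 0 < h)
    (j : ℕ) : Measurable[gridSigma T h (Iio j)] fun ω => gridProd g (T ω) h j := by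
  induction j using Nat.strong_induction_on with
  | _ j ih =>
    rcases Nat.eq_zero_or_pos j with rfl | hj
    · simp only [gridProd]
      exact measurable_const
    simp only [gridProd_of_pos g _ h hj]
    let _ := gridSigma T h (Iio j)
    refine Finset.measurable_sum _ fun i hi => ?_
    have hi' := Finset.mem_range.1 hi
    have h1 := measurable_vacancy_gridSigma T hh (S := Iio j) (i := i + 1) (j := j)
      (fun l hl => hl.2)
    have h2 := measurable_vacancy_gridSigma T hh (S := Iio j) (i := i) (j := j)
      (fun l hl => hl.2)
    have h3 := (ih i hi').mono (gridSigma_mono T h (Iio_subset_Iio hi'.le)) le_rfl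
    exact ((h1.sub h2).mul_const _).mul h3

/-! ### Independence of cells and the discrete renewal equation -/

section Expectation

variable {Ω : Type*} [mΩ : MeasurableSpace Ω] {P : Measure Ω} {k : ℝ}
  {T : Ω → Set ℝ} {h : ℝ} {g : ℝ → ℝ}

theorem gridSigma_le (hT : IsPoissonProcess T (selfSimilarIntensity k) P) (S : Set ℕ) :
    gridSigma T h S ≤ mΩ :=
  iSup₂_le fun _ _ => (hT.measurable_apply measurableSet_Ico).comap_le

theorem iIndepFun_grid (hT : IsPoissonProcess T (selfSimilarIntensity k) P) (hh : 0 < h) :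
    iIndepFun (fun (l : ℕ) ω =>
      pointMeasure (T ω) (Ico ((l : ℝ) * h) ((l + 1 : ℕ) * h))) P := by
  rw [iIndepFun_iff_finset]
  intro s
  obtain ⟨n, hn⟩ := s.exists_nat_subset_range
  have h1 := hT.indep n (fun l => Ico ((l : ℝ) * h) ((l + 1 : ℕ) * h))
    (fun _ => measurableSet_Ico) (fun l m hlm => by
      refine Set.disjoint_left.2 fun x hx hx' => hlm (Fin.ext ?_)
      have e1 := lt_of_mul_lt_mul_right (hx.1.trans_lt hx'.2) hh.le
      have e2 := lt_of_mul_lt_mul_right (hx'.1.trans_lt hx.2) hh.le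
      have e3 : (l : ℕ) < m + 1 := by exact_mod_cast e1
      have e4 : (m : ℕ) < l + 1 := by exact_mod_cast e2
      omega)
  exact h1.precomp (g := fun i : s => (⟨i, Finset.mem_range.1 (hn i.2)⟩ : Fin n))
    (fun i j hij => Subtype.ext (by simpa using hij))

theorem indep_gridSigma (hT : IsPoissonProcess T (selfSimilarIntensity k) P) (hh : 0 < h)
    {S S' : Set ℕ} (hS : Disjoint S S') : Indep (gridSigma T h S) (gridSigma T h S') P :=
  indep_iSup_of_disjoint (fun _ => (hT.measurable_apply measurableSet_Ico).comap_le)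
    ((iIndepFun_iff_iIndep _ _ _).1 (iIndepFun_grid hT hh)) hS

variable [IsProbabilityMeasure P]

/-- The void probability is `exp (-k log (j / i))`. For `i = 0` the mass is infinite, and the
formula persists as `0 ^ k = 0`. -/
theorem integral_vacancy (hk : 0 < k) (hT : IsPoissonProcess T (selfSimilarIntensity k) P)
    (hh : 0 < h) {i j : ℕ} (hij : i ≤ j) (hj : 0 < j) :
    ∫ ω, vacancy (T ω) h i j ∂P = ((i : ℝ) / j) ^ k := by
  rcases Nat.eq_zero_or_pos i with rfl | hi
  · have : (fun ω => vacancy (T ω) h 0 j) =ᵐ[P] fun _ => 0 := by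
      filter_upwards [ae_isSparseConfiguration hk hT] with ω hω
      exact hω.vacancy_zero hh hj
    rw [integral_congr_ae this]
    simp [Real.zero_rpow hk.ne']
  · have hi' : (0 : ℝ) < i := by exact_mod_cast hi
    have hj' : (0 : ℝ) < j := by exact_mod_cast hj
    have hij' : (i : ℝ) ≤ j := by exact_mod_cast hij
    have e : (fun ω => vacancy (T ω) h i j) =
        {ω | T ω ∩ Ico ((i : ℝ) * h) (j * h) = ∅}.indicator fun _ => 1 := by
      ext ω
      simp [vacancy, indicator]
    rw [e, integral_indicator_const _ (hT.measurableSet_empty measurableSet_Ico),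
      hT.measureReal_empty measurableSet_Ico (selfSimilarIntensity_ne_top_of_subset hk
        (mul_pos hi' hh) Ico_subset_Icc_self),
      toReal_selfSimilarIntensity_Ico hk (mul_pos hi' hh) (by gcongr),
      mul_div_mul_right _ _ hh.ne', Real.rpow_def_of_pos (div_pos hi' hj'),
      ← inv_div (i : ℝ), Real.log_inv]
    simp [mul_comm]

theorem integrable_gridProd (hT : IsPoissonProcess T (selfSimilarIntensity k) P)
    (hg01 : ∀ x, g x ∈ Icc (0 : ℝ) 1) (hh : 0 < h) (j : ℕ) :
    Integrable (fun ω => gridProd g (T ω) h j) P := by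
  refine Integrable.of_bound ((measurable_gridProd_gridSigma g T hh j).mono (gridSigma_le hT _)
    le_rfl).aestronglyMeasurable 1 (Eventually.of_forall fun ω => ?_)
  have := gridProd_mem_Icc hg01 (T ω) hh.le j
  rw [Real.norm_of_nonneg this.1]
  exact this.2

theorem integrable_vacancy (hT : IsPoissonProcess T (selfSimilarIntensity k) P)
    (hh : 0 < h) (i j : ℕ) : Integrable (fun ω => vacancy (T ω) h i j) P := by
  refine Integrable.of_bound ((measurable_vacancy_gridSigma T hh subset_rfl).mono
    (gridSigma_le hT _) le_rfl).aestronglyMeasurable 1 (Eventually.of_forall fun ω => ?_)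
  rw [Real.norm_of_nonneg (vacancy_nonneg _ _ _ _)]
  exact vacancy_le_one _ _ _ _

/-- The discrete renewal equation. -/
theorem integral_gridProd (hk : 0 < k) (hT : IsPoissonProcess T (selfSimilarIntensity k) P)
    (hg01 : ∀ x, g x ∈ Icc (0 : ℝ) 1) (hh : 0 < h) {j : ℕ} (hj : 0 < j) :
    ∫ ω, gridProd g (T ω) h j ∂P = ∑ i ∈ Finset.range j,
      ((((i + 1 : ℕ) : ℝ) / j) ^ k - ((i : ℝ) / j) ^ k) *
        g ((j - i) * h) * ∫ ω, gridProd g (T ω) h i ∂P := by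
  simp only [gridProd_of_pos g _ h hj]
  -- Whether cell `i` is the last occupied one is decided by cells `≥ i`, the product up to `i` by
  -- cells `< i`: this is the renewal property.
  have hterm : ∀ i ∈ Finset.range j,
      IndepFun (fun ω => vacancy (T ω) h (i + 1) j - vacancy (T ω) h i j)
        (fun ω => gridProd g (T ω) h i) P := by
    intro i hi
    have hind := indep_gridSigma hT hh (S := Ici i) (S' := Iio i)
      (Set.disjoint_left.2 fun l h1 h2 => absurd (mem_Iio.1 h2) (not_lt.2 h1))
    have m1 : Measurable[gridSigma T h (Ici i)]
        fun ω => vacancy (T ω) h (i + 1) j - vacancy (T ω) h i j := by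
      let _ := gridSigma T h (Ici i)
      exact (measurable_vacancy_gridSigma T hh fun l hl => (Nat.le_succ i).trans hl.1).sub
        (measurable_vacancy_gridSigma T hh fun l hl => hl.1)
    exact indep_of_indep_of_le_left (indep_of_indep_of_le_right hind
      (measurable_gridProd_gridSigma g T hh i).comap_le) m1.comap_le
  have hv := fun i l => integrable_vacancy (h := h) hT hh i l
  have hF := fun i => integrable_gridProd (h := h) (g := g) hT hg01 hh i
  have e : ∀ i ω, (vacancy (T ω) h (i + 1) j - vacancy (T ω) h i j) * g ((j - i) * h) *
      gridProd g (T ω) h i = g ((j - i) * h) *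
        ((vacancy (T ω) h (i + 1) j - vacancy (T ω) h i j) * gridProd g (T ω) h i) :=
    fun i ω => by ring
  simp only [e]
  have hint : ∀ i ∈ Finset.range j, Integrable (fun ω =>
      (vacancy (T ω) h (i + 1) j - vacancy (T ω) h i j) * gridProd g (T ω) h i) P := fun i hi =>
    (hterm i hi).integrable_mul ((hv _ _).sub (hv _ _)) (hF i)
  rw [integral_finsetSum _ fun i hi => (hint i hi).const_mul _]
  refine Finset.sum_congr rfl fun i hi => ?_
  have hi' := Finset.mem_range.1 hi
  rw [integral_const_mul, (hterm i hi).integral_fun_mul_eq_mul_integral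
    ((hv _ _).sub (hv _ _)).aestronglyMeasurable (hF i).aestronglyMeasurable,
    integral_sub (hv _ _) (hv _ _), integral_vacancy hk hT hh hi' hj,
    integral_vacancy hk hT hh hi'.le hj]
  ring

/-- On each cell the floor is constant and `k s^(k-1)` integrates to a difference of `k`-th powers.
Written as an integral, the discrete equation is ready for dominated convergence. -/
theorem integral_rpow_grid (hk : 0 < k) (hh : 0 < h) (u : ℕ → ℝ) (j : ℕ) :
    ∫ s in (0 : ℝ)..(j * h), k * s ^ (k - 1) * u ⌊s / h⌋₊ =
      ∑ i ∈ Finset.range j, ((((i + 1 : ℕ) : ℝ) * h) ^ k - ((i : ℝ) * h) ^ k) * u i := by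
  have hcell : ∀ i : ℕ, ∀ s ∈ Ioo ((i : ℝ) * h) ((i + 1 : ℕ) * h), ⌊s / h⌋₊ = i := by
    intro i s hs
    have h0 : 0 ≤ s / h := div_nonneg (le_trans (by positivity) hs.1.le) hh.le
    rw [Nat.floor_eq_iff h0, le_div_iff₀ hh, div_lt_iff₀ hh]
    exact ⟨hs.1.le, by exact_mod_cast hs.2⟩
  have hle : ∀ i : ℕ, (i : ℝ) * h ≤ (i + 1 : ℕ) * h := fun i => by
    gcongr; exact Nat.le_succ i
  have hae : ∀ i : ℕ, (fun s : ℝ => k * s ^ (k - 1) * u ⌊s / h⌋₊)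
      =ᵐ[volume.restrict (Ioc ((i : ℝ) * h) ((i + 1 : ℕ) * h))]
        fun s => k * s ^ (k - 1) * u i := by
    intro i
    rw [← restrict_Ioo_eq_restrict_Ioc]
    filter_upwards [ae_restrict_mem measurableSet_Ioo] with s hs
    rw [hcell i s hs]
  have hint : ∀ x y : ℝ, ∀ c : ℝ,
      IntervalIntegrable (fun s => k * s ^ (k - 1) * c) volume x y := fun x y c =>
    ((intervalIntegral.intervalIntegrable_rpow' (by linarith)).const_mul k).mul_const c
  have hii : ∀ i < j, IntervalIntegrable (fun s : ℝ => k * s ^ (k - 1) * u ⌊s / h⌋₊) volume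
      ((i : ℕ) * h) ((i + 1 : ℕ) * h) := by
    intro i _
    refine (hint _ _ (u i)).congr_ae ?_
    rw [uIoc_of_le (hle i)]
    exact (hae i).symm
  have hsum := intervalIntegral.sum_integral_adjacent_intervals (a := fun i : ℕ => (i : ℝ) * h) hii
  simp only [Nat.cast_zero, zero_mul] at hsum
  rw [← hsum]
  refine Finset.sum_congr rfl fun i _ => ?_
  rw [intervalIntegral.integral_of_le (hle i), integral_congr_ae (hae i),
    ← intervalIntegral.integral_of_le (hle i), intervalIntegral.integral_mul_const,
    intervalIntegral.integral_const_mul, integral_rpow (Or.inl (by linarith))]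
  rw [sub_add_cancel]
  field_simp

theorem integral_gridProd_eq_integral (hk : 0 < k)
    (hT : IsPoissonProcess T (selfSimilarIntensity k) P)
    (hg01 : ∀ x, g x ∈ Icc (0 : ℝ) 1) (hh : 0 < h) {j : ℕ} (hj : 0 < j) :
    ((j : ℝ) * h) ^ k * ∫ ω, gridProd g (T ω) h j ∂P =
      ∫ s in (0 : ℝ)..(j * h), k * s ^ (k - 1) *
        (g ((j - ⌊s / h⌋₊) * h) * ∫ ω, gridProd g (T ω) h ⌊s / h⌋₊ ∂P) := by
  rw [integral_rpow_grid hk hh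
    (fun i => g ((j - i) * h) * ∫ ω, gridProd g (T ω) h i ∂P), integral_gridProd hk hT hg01 hh hj,
    Finset.mul_sum]
  refine Finset.sum_congr rfl fun i _ => ?_
  have hj' : (0 : ℝ) < j := by exact_mod_cast hj
  have e : ∀ l : ℕ, ((l : ℝ) * h) ^ k = ((j : ℝ) * h) ^ k * ((l : ℝ) / j) ^ k := fun l => by
    rw [← Real.mul_rpow (by positivity) (by positivity)]
    congr 1
    field_simp
  rw [e i, e (i + 1)]
  ring

end Expectation

/-! ### The continuous renewal equation and the generating functional -/

theorem spacingProdBefore_of_nonpos {D : Set ℝ} {g : ℝ → ℝ} {a b t : ℝ}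
    (hD : IsSparseConfiguration D) (ha : 0 < a) (hg1 : ∀ x, x ∉ Ioo a b → g x = 1) (ht : t ≤ 0) :
    spacingProdBefore g D t = 1 := by
  have : D ∩ Iio t = ∅ := by
    rw [eq_empty_iff_forall_notMem]
    rintro u ⟨hu, hut⟩
    exact absurd (hut.trans_le ht) (not_lt.2 (hD.pos u hu).le)
  -- With no point before `t`, `lastBefore` takes the default value `sSup ∅ = 0`, and the spacing `t
  -- - 0 ≤ 0` is invisible to `g`.
  rw [spacingProdBefore, lastBefore, this, Real.sSup_empty, sub_zero,
    hg1 t fun h => absurd h.1 (not_lt.2 (ht.trans ha.le)), finprod_mem_empty, one_mul]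

section Renewal

variable {Ω : Type*} [mΩ : MeasurableSpace Ω] {P : Measure Ω} [IsProbabilityMeasure P] {k : ℝ}
  {T : Ω → Set ℝ} {g : ℝ → ℝ} {a b : ℝ}

theorem ae_tendsto_gridProd (hk : 0 < k) (hT : IsPoissonProcess T (selfSimilarIntensity k) P)
    (ha : 0 < a) (hg : Continuous g) (hg1 : ∀ x, x ∉ Ioo a b → g x = 1) (t : ℝ) :
    ∀ᵐ ω ∂P, Tendsto (fun h => gridProd g (T ω) h ⌊t / h⌋₊) (𝓝[>] 0)
      (𝓝 (spacingProdBefore g (T ω) t)) := by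
  filter_upwards [ae_isSparseConfiguration hk hT] with ω hω
  rcases lt_or_ge 0 t with ht | ht
  · exact hω.tendsto_gridProd ha hg hg1 ht
  · rw [spacingProdBefore_of_nonpos hω ha hg1 ht]
    refine tendsto_const_nhds.congr' ?_
    filter_upwards [self_mem_nhdsWithin] with h hh
    rw [Nat.floor_of_nonpos (div_nonpos_of_nonpos_of_nonneg ht (le_of_lt hh)), gridProd]

theorem aemeasurable_spacingProdBefore (hk : 0 < k)
    (hT : IsPoissonProcess T (selfSimilarIntensity k) P)
    (ha : 0 < a) (hg : Continuous g) (hg1 : ∀ x, x ∉ Ioo a b → g x = 1) (t : ℝ) :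
    AEMeasurable (fun ω => spacingProdBefore g (T ω) t) P := by
  have hlim : Tendsto (fun n : ℕ => 1 / ((n : ℝ) + 1)) atTop (𝓝[>] 0) :=
    tendsto_nhdsWithin_iff.2 ⟨tendsto_one_div_add_atTop_nhds_zero_nat,
      Eventually.of_forall fun n => mem_Ioi.2 (by positivity)⟩
  refine aemeasurable_of_tendsto_metrizable_ae atTop
    (f := fun (n : ℕ) ω => gridProd g (T ω) (1 / ((n : ℝ) + 1)) ⌊t / (1 / ((n : ℝ) + 1))⌋₊)
    (fun n => ?_) ?_
  · exact ((measurable_gridProd_gridSigma g T (by positivity) _).mono (gridSigma_le hT _)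
      le_rfl).aemeasurable
  · filter_upwards [ae_tendsto_gridProd hk hT ha hg hg1 t] with ω hω
    exact hω.comp hlim

theorem tendsto_integral_gridProd (hk : 0 < k)
    (hT : IsPoissonProcess T (selfSimilarIntensity k) P) (ha : 0 < a) (hg : Continuous g)
    (hg01 : ∀ x, g x ∈ Icc (0 : ℝ) 1) (hg1 : ∀ x, x ∉ Ioo a b → g x = 1) (t : ℝ) :
    Tendsto (fun h => ∫ ω, gridProd g (T ω) h ⌊t / h⌋₊ ∂P) (𝓝[>] 0)
      (𝓝 (∫ ω, spacingProdBefore g (T ω) t ∂P)) := by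
  refine tendsto_integral_filter_of_dominated_convergence (fun _ => 1) ?_ ?_
    (integrable_const 1) (ae_tendsto_gridProd hk hT ha hg hg1 t)
  · filter_upwards [self_mem_nhdsWithin] with h hh
    exact (integrable_gridProd hT hg01 hh _).aestronglyMeasurable
  · filter_upwards [self_mem_nhdsWithin] with h hh
    refine Eventually.of_forall fun ω => ?_
    have := gridProd_mem_Icc hg01 (T ω) (le_of_lt hh) ⌊t / h⌋₊
    rw [Real.norm_of_nonneg this.1]
    exact this.2

theorem integral_gridProd_mem_Icc (hT : IsPoissonProcess T (selfSimilarIntensity k) P)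
    (hg01 : ∀ x, g x ∈ Icc (0 : ℝ) 1) {h : ℝ} (hh : 0 < h) (j : ℕ) :
    ∫ ω, gridProd g (T ω) h j ∂P ∈ Icc (0 : ℝ) 1 := by
  have hm := fun ω => gridProd_mem_Icc hg01 (T ω) hh.le j
  refine ⟨integral_nonneg fun ω => (hm ω).1, ?_⟩
  calc _ ≤ ∫ _, (1 : ℝ) ∂P := integral_mono (integrable_gridProd hT hg01 hh j)
        (integrable_const 1) fun ω => (hm ω).2
    _ = 1 := by simp

theorem integral_spacingProdBefore_mem_Icc (hk : 0 < k)
    (hT : IsPoissonProcess T (selfSimilarIntensity k) P) (ha : 0 < a) (hg : Continuous g)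
    (hg01 : ∀ x, g x ∈ Icc (0 : ℝ) 1) (hg1 : ∀ x, x ∉ Ioo a b → g x = 1) (t : ℝ) :
    ∫ ω, spacingProdBefore g (T ω) t ∂P ∈ Icc (0 : ℝ) 1 := by
  refine isClosed_Icc.mem_of_tendsto (tendsto_integral_gridProd hk hT ha hg hg01 hg1 t) ?_
  filter_upwards [self_mem_nhdsWithin] with h hh
  exact integral_gridProd_mem_Icc hT hg01 hh _

theorem measurable_integral_spacingProdBefore (hk : 0 < k)
    (hT : IsPoissonProcess T (selfSimilarIntensity k) P) (ha : 0 < a) (hg : Continuous g)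
    (hg01 : ∀ x, g x ∈ Icc (0 : ℝ) 1) (hg1 : ∀ x, x ∉ Ioo a b → g x = 1) :
    Measurable fun t => ∫ ω, spacingProdBefore g (T ω) t ∂P := by
  refine measurable_of_tendsto_metrizable' (𝓝[>] (0 : ℝ))
    (f := fun h t => ∫ ω, gridProd g (T ω) h ⌊t / h⌋₊ ∂P) (fun h => ?_)
    (tendsto_pi_nhds.2 fun t => tendsto_integral_gridProd hk hT ha hg hg01 hg1 t)
  exact (measurable_from_top (f := fun j : ℕ => ∫ ω, gridProd g (T ω) h j ∂P)).comp
    (Nat.measurable_floor.comp (measurable_id.div_const h))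

/-- The renewal equation. -/
theorem rpow_mul_integral_spacingProdBefore (hk : 0 < k)
    (hT : IsPoissonProcess T (selfSimilarIntensity k) P) (ha : 0 < a) (hg : Continuous g)
    (hg01 : ∀ x, g x ∈ Icc (0 : ℝ) 1) (hg1 : ∀ x, x ∉ Ioo a b → g x = 1) {t : ℝ} (ht : 0 < t) :
    t ^ k * ∫ ω, spacingProdBefore g (T ω) t ∂P =
      ∫ s in (0 : ℝ)..t, k * s ^ (k - 1) * (∫ ω, spacingProdBefore g (T ω) s ∂P) * g (t - s) := by
  have hfl := tendsto_floor_div_mul ht.le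
  have hL : Tendsto (fun h : ℝ => ((⌊t / h⌋₊ : ℝ) * h) ^ k *
      ∫ ω, gridProd g (T ω) h ⌊t / h⌋₊ ∂P) (𝓝[>] 0)
      (𝓝 (t ^ k * ∫ ω, spacingProdBefore g (T ω) t ∂P)) :=
    (hfl.rpow_const (Or.inl ht.ne')).mul (tendsto_integral_gridProd hk hT ha hg hg01 hg1 t)
  set F : ℝ → ℝ → ℝ := fun h s => k * s ^ (k - 1) *
        (g (((⌊t / h⌋₊ : ℝ) - ⌊s / h⌋₊) * h) * ∫ ω, gridProd g (T ω) h ⌊s / h⌋₊ ∂P) with hF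
  have hFm : ∀ h, Measurable (F h) := fun h => by
    have hfloor : Measurable fun s : ℝ => ⌊s / h⌋₊ :=
      Nat.measurable_floor.comp (measurable_id.div_const h)
    refine Measurable.mul (by fun_prop) ?_
    exact (measurable_from_top (f := fun j : ℕ => g (((⌊t / h⌋₊ : ℝ) - j) * h) *
      ∫ ω, gridProd g (T ω) h j ∂P)).comp hfloor
  -- The upper limit of integration moves with `h`; the indicator puts all the integrals on the
  -- fixed interval `(0, t]`.
  have hR : Tendsto (fun h : ℝ => ∫ s in Ioc 0 t,
      (Ioc 0 ((⌊t / h⌋₊ : ℝ) * h)).indicator (F h) s) (𝓝[>] 0)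
      (𝓝 (∫ s in Ioc 0 t,
        k * s ^ (k - 1) * (∫ ω, spacingProdBefore g (T ω) s ∂P) * g (t - s))) := by
    refine tendsto_integral_filter_of_dominated_convergence (fun s => k * s ^ (k - 1))
      (Eventually.of_forall fun h =>
        ((hFm h).indicator measurableSet_Ioc).aestronglyMeasurable) ?_ ?_ ?_
    · filter_upwards [self_mem_nhdsWithin] with h hh
      filter_upwards [ae_restrict_mem measurableSet_Ioc] with s hs
      have hs0 := hs.1
      refine (norm_indicator_le_norm_self _ _).trans ?_
      have h1 := hg01 (((⌊t / h⌋₊ : ℝ) - ⌊s / h⌋₊) * h)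
      have h2 := integral_gridProd_mem_Icc (g := g) hT hg01 hh ⌊s / h⌋₊
      have h3 := mul_nonneg h1.1 h2.1
      have h4 : 0 ≤ k * s ^ (k - 1) := by positivity
      rw [Real.norm_of_nonneg (mul_nonneg h4 h3)]
      exact mul_le_of_le_one_right h4 (mul_le_one₀ h1.2 h2.1 h2.2)
    · have := (intervalIntegral.intervalIntegrable_rpow' (a := 0) (b := t)
        (show -1 < k - 1 by linarith)).const_mul k
      exact (intervalIntegrable_iff_integrableOn_Ioc_of_le ht.le).1 this
    -- Dropping the end point `s = t` makes the indicator eventually 1 at every remaining `s`.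
    · rw [← restrict_Ioo_eq_restrict_Ioc]
      filter_upwards [ae_restrict_mem measurableSet_Ioo] with s hs
      have hF' : Tendsto (fun h => F h s) (𝓝[>] 0)
          (𝓝 (k * s ^ (k - 1) * (∫ ω, spacingProdBefore g (T ω) s ∂P) * g (t - s))) := by
        rw [mul_assoc, mul_comm (∫ ω, spacingProdBefore g (T ω) s ∂P)]
        refine Tendsto.const_mul _ (Tendsto.mul ?_
          (tendsto_integral_gridProd hk hT ha hg hg01 hg1 s))
        refine (hg.tendsto _).comp ?_
        simp only [sub_mul]
        exact hfl.sub (tendsto_floor_div_mul hs.1.le)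
      refine hF'.congr' ?_
      filter_upwards [hfl.eventually (lt_mem_nhds hs.2)] with h hh
      have hmem : s ∈ Ioc 0 ((⌊t / h⌋₊ : ℝ) * h) := ⟨hs.1, hh.le⟩
      rw [indicator_of_mem hmem]
  rw [intervalIntegral.integral_of_le ht.le]
  refine tendsto_nhds_unique hL (hR.congr' ?_)
  filter_upwards [Ioo_mem_nhdsGT ht] with h hh
  have hh0 : 0 < h := hh.1
  have hj : 0 < ⌊t / h⌋₊ := Nat.floor_pos.2 ((one_le_div hh0).2 hh.2.le)
  have f1 := Nat.floor_le (div_nonneg ht.le hh0.le)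
  rw [le_div_iff₀ hh0] at f1
  rw [integral_gridProd_eq_integral hk hT hg01 hh0 hj,
    intervalIntegral.integral_of_le (by positivity), integral_indicator measurableSet_Ioc,
    Measure.restrict_restrict measurableSet_Ioc,
    inter_eq_left.2 (Ioc_subset_Ioc_right f1)]

/-- The window `[u n - b, u n)` is occupied with probability at most `k b / 2^n`; the geometric
growth of `u` makes this summable for Borel–Cantelli. -/
theorem ae_spacingProdBefore_eventually_eq (hk : 0 < k)
    (hT : IsPoissonProcess T (selfSimilarIntensity k) P) (hb : 0 < b)
    (hg1 : ∀ x, x ∉ Ioo a b → g x = 1)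
    {u : ℕ → ℝ} (hu : ∀ n, 2 ^ n + b ≤ u n) :
    ∀ᵐ ω ∂P, ∀ᶠ n in atTop, spacingProdBefore g (T ω) (u n) = spacingProd g (T ω) := by
  have h1 : ∀ᵐ ω ∂P, ∀ᶠ n in atTop, ¬ (T ω ∩ Ico (u n - b) (u n) ≠ ∅) := by
    refine ae_eventually_notMem (μ := P) (s := fun n => {ω | T ω ∩ Ico (u n - b) (u n) ≠ ∅}) ?_
    have hs : Summable fun n : ℕ => k * b * (1 / 2 : ℝ) ^ n := summable_geometric_two.mul_left _
    refine ne_top_of_le_ne_top hs.tsum_ofReal_ne_top (ENNReal.tsum_le_tsum fun n => ?_)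
    have hpos : (0 : ℝ) < 2 ^ n := by positivity
    have := hu n
    refine (measure_inter_Ico_ne_empty_le hk hT hb (by linarith)).trans
      (ENNReal.ofReal_le_ofReal ?_)
    rw [one_div, inv_pow, ← div_eq_mul_inv]
    gcongr
    linarith
  filter_upwards [h1, ae_isSparseConfiguration hk hT] with ω h1 hω
  obtain ⟨M, hM⟩ := hω.spacingProdBefore_eq_spacingProd hb hg1
  have hu' : Tendsto u atTop atTop := tendsto_atTop_mono (fun n => (hu n).trans' (by linarith))
    (tendsto_pow_atTop_atTop_of_one_lt (one_lt_two (α := ℝ)))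
  filter_upwards [h1, hu'.eventually_ge_atTop M] with n hn hMn
  exact hM _ hMn (not_not.1 hn)

theorem aemeasurable_spacingProd (hk : 0 < k)
    (hT : IsPoissonProcess T (selfSimilarIntensity k) P) (ha : 0 < a) (hb : 0 < b)
    (hg : Continuous g) (hg1 : ∀ x, x ∉ Ioo a b → g x = 1) :
    AEMeasurable (fun ω => spacingProd g (T ω)) P := by
  refine aemeasurable_of_tendsto_metrizable_ae atTop
    (f := fun n ω => spacingProdBefore g (T ω) (2 ^ n + b))
    (fun n => aemeasurable_spacingProdBefore hk hT ha hg hg1 _) ?_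
  filter_upwards [ae_spacingProdBefore_eventually_eq hk hT hb hg1 (u := fun n => 2 ^ n + b)
    fun n => le_rfl] with ω hω
  exact tendsto_const_nhds.congr' (hω.mono fun n hn => hn.symm)

theorem spacingProdBefore_mem_Icc (hg01 : ∀ x, g x ∈ Icc (0 : ℝ) 1) (D : Set ℝ) (t : ℝ) :
    spacingProdBefore g D t ∈ Icc (0 : ℝ) 1 := by
  have h1 : (∏ᶠ s ∈ D ∩ Iio t, g (s - lastBefore D s)) ∈ Icc (0 : ℝ) 1 :=
    finprod_mem_induction (· ∈ Icc (0 : ℝ) 1) (by simp)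
      (fun x y hx hy => ⟨mul_nonneg hx.1 hy.1, mul_le_one₀ hx.2 hy.1 hy.2⟩) fun s _ => hg01 _
  exact ⟨mul_nonneg (hg01 _).1 h1.1, mul_le_one₀ (hg01 _).2 h1.1 h1.2⟩

/-- The generating functional of the spacings, on continuous functions. -/
theorem integral_spacingProd_of_continuous (hk : 0 < k)
    (hT : IsPoissonProcess T (selfSimilarIntensity k) P) (ha : 0 < a) (hb : 0 < b)
    (hg : Continuous g) (hg01 : ∀ x, g x ∈ Icc (0 : ℝ) 1) (hg1 : ∀ x, x ∉ Ioo a b → g x = 1) :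
    ∫ ω, spacingProd g (T ω) ∂P = Real.exp (-∫ x, (1 - g x) ∂selfSimilarIntensity k) := by
  rw [integral_selfSimilarIntensity hk]
  refine limit_of_renewal (φ := fun t => ∫ ω, spacingProdBefore g (T ω) t ∂P) hk ha hg hg01
    (fun x hx => hg1 x fun h => hx (Ioo_subset_Icc_self h))
    (measurable_integral_spacingProdBefore hk hT ha hg hg01 hg1)
    (integral_spacingProdBefore_mem_Icc hk hT ha hg hg01 hg1) (fun t ht hta => ?_)
    (fun t ht => rpow_mul_integral_spacingProdBefore hk hT ha hg hg01 hg1 ht) ?_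
  · have : (fun ω => spacingProdBefore g (T ω) t) =ᵐ[P] fun _ => 1 := by
      filter_upwards [ae_isSparseConfiguration hk hT] with ω hω
      exact hω.spacingProdBefore_of_le hg1 ht hta
    rw [integral_congr_ae this]
    simp
  -- Almost sure convergence is known only along times growing at least geometrically; such times
  -- can be selected from any sequence tending to infinity, which suffices for the limit of
  -- expectations.
  · refine tendsto_of_subseq_tendsto fun u hu => ?_
    have hex : ∀ n : ℕ, ∃ m, 2 ^ n + b ≤ u m := fun n => (hu.eventually_ge_atTop _).exists
    choose ms hms using hex
    refine ⟨ms, ?_⟩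
    refine tendsto_integral_of_dominated_convergence (fun _ => 1)
      (fun n => (aemeasurable_spacingProdBefore hk hT ha hg hg1 _).aestronglyMeasurable)
      (integrable_const 1) (fun n => Eventually.of_forall fun ω => ?_) ?_
    · have := spacingProdBefore_mem_Icc hg01 (T ω) (u (ms n))
      rw [Real.norm_of_nonneg this.1]
      exact this.2
    · filter_upwards [ae_spacingProdBefore_eventually_eq hk hT hb hg1 hms] with ω hω
      exact tendsto_const_nhds.congr' (hω.mono fun n hn => hn.symm)

end Renewal

/-! ### Spacings counted with multiplicity -/

/-- The spacings of `D` counted with multiplicity. -/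
noncomputable def spacingMeasure (D : Set ℝ) : Measure ℝ :=
  Measure.sum fun s : D => Measure.dirac ((s : ℝ) - lastBefore D s)

theorem spacingMeasure_apply (D : Set ℝ) {A : Set ℝ} (hA : MeasurableSet A) :
    spacingMeasure D A = {s ∈ D | s - lastBefore D s ∈ A}.encard := by
  rw [spacingMeasure, Measure.sum_apply _ hA, ← ENNReal.tsum_set_one,
    tsum_subtype D (fun s => Measure.dirac (s - lastBefore D s) A),
    tsum_subtype {s ∈ D | s - lastBefore D s ∈ A} fun _ => (1 : ℝ≥0∞)]
  refine tsum_congr fun s => ?_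
  simp only [Measure.dirac_apply' _ hA]
  by_cases hs : s ∈ D <;> by_cases h : s - lastBefore D s ∈ A <;> simp [indicator, hs, h]

namespace IsSparseConfiguration

variable {D : Set ℝ} {g : ℝ → ℝ} {a b : ℝ}

theorem spacingProd_eq_prod (hD : IsSparseConfiguration D) (ha : 0 < a)
    (hg1 : ∀ x, x ∉ Ioo a b → g x = 1) :
    spacingProd g D = ∏ s ∈ (hD.finite_spacing_mem ha b).toFinset, g (s - lastBefore D s) := by
  refine finprod_mem_eq_prod_of_inter_mulSupport_eq _ ?_
  ext s
  simp only [mem_inter_iff, Finite.coe_toFinset, mem_ofPred_eq, Function.mem_mulSupport]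
  constructor
  · rintro ⟨hs, h⟩
    exact ⟨⟨hs, by by_contra h'; exact h (hg1 _ h')⟩, h⟩
  · rintro ⟨⟨hs, _⟩, h⟩
    exact ⟨hs, h⟩

theorem exp_neg_lintegral_spacingMeasure (hD : IsSparseConfiguration D) (ha : 0 < a) {f : ℝ → ℕ}
    (hf : Measurable f) (hf0 : ∀ x, x ∉ Ioo a b → f x = 0) :
    Real.exp (-(∫⁻ x, (f x : ℝ≥0∞) ∂spacingMeasure D).toReal) =
      spacingProd (fun x => Real.exp (-(f x : ℝ))) D := by
  rw [hD.spacingProd_eq_prod ha (b := b) fun x hx => by simp [hf0 x hx], ← Real.exp_sum,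
    spacingMeasure, lintegral_sum_measure]
  have hfm : Measurable fun x => (f x : ℝ≥0∞) := by fun_prop
  simp_rw [lintegral_dirac' _ hfm]
  rw [tsum_subtype D (fun s => (f (s - lastBefore D s) : ℝ≥0∞)),
    tsum_eq_sum (s := (hD.finite_spacing_mem ha b).toFinset), ENNReal.toReal_sum,
    ← Finset.sum_neg_distrib]
  · refine congrArg Real.exp (Finset.sum_congr rfl fun s hs => ?_)
    have hs' := ((hD.finite_spacing_mem ha b).mem_toFinset.1 hs).1
    rw [indicator_of_mem hs', ENNReal.toReal_natCast]
  · intro s _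
    by_cases hs : s ∈ D <;> simp [hs]
  · intro s hs
    by_cases hsD : s ∈ D
    · rw [indicator_of_mem hsD, hf0 _ fun h => hs
        ((hD.finite_spacing_mem ha b).mem_toFinset.2 ⟨hsD, h⟩), Nat.cast_zero]
    · rw [indicator_of_notMem hsD]

theorem spacingMeasure_Ioo_lt_top (hD : IsSparseConfiguration D) (ha : 0 < a) (b : ℝ) :
    spacingMeasure D (Ioo a b) < ∞ := by
  rw [spacingMeasure_apply D measurableSet_Ioo]
  have := (hD.finite_spacing_mem ha b).encard_lt_top
  exact_mod_cast this

theorem spacingMeasure_Iic_zero (hD : IsSparseConfiguration D) : spacingMeasure D (Iic 0) = 0 := by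
  rw [spacingMeasure_apply D measurableSet_Iic]
  have : {s ∈ D | s - lastBefore D s ∈ Iic 0} = ∅ := by
    rw [eq_empty_iff_forall_notMem]
    rintro s ⟨hs, h⟩
    have := hD.lastBefore_lt (hD.pos s hs)
    have h' : s - lastBefore D s ≤ 0 := h
    linarith
  rw [this, encard_empty, ENat.toENNReal_zero]

theorem pointMeasure_Ioo_lt_top (hD : IsSparseConfiguration D) (ha : 0 < a) (b : ℝ) :
    pointMeasure D (Ioo a b) < ∞ :=
  (pointMeasure_lt_top_iff measurableSet_Ioo).2
    ((hD.finite a b ha).subset (inter_subset_inter_right _ Ioo_subset_Icc_self))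

theorem pointMeasure_Iic_zero (hD : IsSparseConfiguration D) : pointMeasure D (Iic 0) = 0 := by
  rw [pointMeasure_eq_zero_iff measurableSet_Iic, eq_empty_iff_forall_notMem]
  rintro s ⟨hs, h⟩
  exact absurd (hD.pos s hs) (not_lt.2 h)

theorem countable (hD : IsSparseConfiguration D) : D.Countable := by
  have : D ⊆ ⋃ n : ℕ, D ∩ Icc (1 / ((n : ℝ) + 1)) n := by
    intro s hs
    obtain ⟨n, hn⟩ := exists_nat_one_div_lt (hD.pos s hs)
    obtain ⟨m, hm⟩ := exists_nat_ge s
    refine mem_iUnion.2 ⟨max n m, hs, ?_, hm.trans (by exact_mod_cast le_max_right n m)⟩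
    refine le_trans ?_ hn.le
    gcongr
    exact_mod_cast le_max_left n m
  exact (countable_iUnion fun n : ℕ => (hD.finite _ _ (by positivity)).countable).mono this

/-- Injectivity preserves cardinalities under the image, and countability makes the set of spacings
measurable, so that `Measure.count` is its cardinality. -/
theorem pointMeasure_spacings (hD : IsSparseConfiguration D)
    (hinj : InjOn (fun s => s - lastBefore D s) D) :
    pointMeasure (spacings D) = spacingMeasure D := by
  ext A hA
  have hc : (spacings D).Countable := by
    rw [hD.spacings_eq_image]
    exact hD.countable.image _
  rw [spacingMeasure_apply D hA, pointMeasure_apply _ hA,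
    Measure.count_apply (hc.mono inter_subset_left).measurableSet, hD.spacings_eq_image,
    ← image_inter_preimage, InjOn.encard_image (hinj.mono inter_subset_left)]
  rfl

end IsSparseConfiguration

/-! ### Laplace functionals on rational step functions -/

/-- Rational intervals `(p, q)` with `0 < p`. -/
abbrev RatInterval : Type := {pq : ℚ × ℚ // 0 < pq.1}

/-- The open real interval with the given rational end points. -/
def RatInterval.toSet (i : RatInterval) : Set ℝ := Ioo (i.1.1 : ℝ) i.1.2

theorem RatInterval.measurableSet_toSet (i : RatInterval) : MeasurableSet i.toSet :=
  measurableSet_Ioo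

theorem RatInterval.fst_pos (i : RatInterval) : (0 : ℝ) < i.1.1 := by exact_mod_cast i.2

open Classical in
/-- The integer valued step function `∑ i, n i • 1_{i}`. -/
noncomputable def stepFun (n : RatInterval →₀ ℕ) (x : ℝ) : ℕ :=
  n.sum fun i m => if x ∈ i.toSet then m else 0

theorem measurable_stepFun (n : RatInterval →₀ ℕ) : Measurable (stepFun n) :=
  Finset.measurable_sum _ fun i _ =>
    Measurable.ite i.measurableSet_toSet measurable_const measurable_const

theorem stepFun_le (n : RatInterval →₀ ℕ) (x : ℝ) : stepFun n x ≤ n.sum fun _ m => m :=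
  Finset.sum_le_sum fun i _ => by dsimp only; split_ifs <;> simp

theorem exists_stepFun_eq_zero (n : RatInterval →₀ ℕ) :
    ∃ a b : ℝ, 0 < a ∧ 0 < b ∧ ∀ i ∈ n.support, i.toSet ⊆ Ioo a b := by
  induction n.support using Finset.induction_on with
  | empty => exact ⟨1, 1, one_pos, one_pos, by simp⟩
  | insert i s _ ih =>
    obtain ⟨a, b, ha, hb, hab⟩ := ih
    refine ⟨min a i.1.1, max b i.1.2, lt_min ha i.fst_pos, lt_max_of_lt_left hb, ?_⟩
    intro j hj
    rcases Finset.mem_insert.1 hj with rfl | hj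
    · exact Ioo_subset_Ioo (min_le_right _ _) (le_max_right _ _)
    · exact (hab j hj).trans (Ioo_subset_Ioo (min_le_left _ _) (le_max_left _ _))

theorem stepFun_eq_zero {n : RatInterval →₀ ℕ} {a b : ℝ}
    (hab : ∀ i ∈ n.support, i.toSet ⊆ Ioo a b) {x : ℝ} (hx : x ∉ Ioo a b) : stepFun n x = 0 :=
  Finset.sum_eq_zero fun i hi => if_neg fun h => hx (hab i hi h)

theorem lintegral_stepFun (n : RatInterval →₀ ℕ) (μ : Measure ℝ) :
    ∫⁻ x, (stepFun n x : ℝ≥0∞) ∂μ = n.sum fun i m => (m : ℝ≥0∞) * μ i.toSet := by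
  classical
  have e : ∀ x, (stepFun n x : ℝ≥0∞) =
      ∑ i ∈ n.support, (n i : ℝ≥0∞) * i.toSet.indicator (fun _ => 1) x := by
    intro x
    simp only [stepFun, Finsupp.sum, Nat.cast_sum]
    refine Finset.sum_congr rfl fun i _ => ?_
    by_cases h : x ∈ i.toSet <;> simp [h]
  simp_rw [e]
  rw [lintegral_finsetSum _ fun i _ =>
    (measurable_const.indicator i.measurableSet_toSet).const_mul _]
  refine Finset.sum_congr rfl fun i _ => ?_
  rw [lintegral_const_mul _ (measurable_const.indicator i.measurableSet_toSet),
    lintegral_indicator i.measurableSet_toSet]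
  simp

/-- Continuous functions which converge to the indicator function of `i` as `m → ∞`. -/
noncomputable def RatInterval.approx (i : RatInterval) (m : ℕ) (x : ℝ) : ℝ :=
  max 0 (min 1 (m * min (x - i.1.1) (i.1.2 - x)))

theorem RatInterval.continuous_approx (i : RatInterval) (m : ℕ) : Continuous (i.approx m) := by
  unfold RatInterval.approx
  fun_prop

theorem RatInterval.approx_nonneg (i : RatInterval) (m : ℕ) (x : ℝ) : 0 ≤ i.approx m x :=
  le_max_left _ _

theorem RatInterval.approx_of_notMem (i : RatInterval) (m : ℕ) {x : ℝ} (hx : x ∉ i.toSet) :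
    i.approx m x = 0 := by
  have h : min (x - i.1.1) (i.1.2 - x) ≤ (0 : ℝ) := by
    by_contra! hcon
    rw [lt_min_iff] at hcon
    exact hx ⟨by linarith [hcon.1], by linarith [hcon.2]⟩
  exact max_eq_left ((min_le_right _ _).trans
    (mul_nonpos_of_nonneg_of_nonpos (Nat.cast_nonneg m) h))

theorem RatInterval.tendsto_approx (i : RatInterval) (x : ℝ) :
    Tendsto (fun m => i.approx m x) atTop (𝓝 (i.toSet.indicator (fun _ => 1) x)) := by
  by_cases hx : x ∈ i.toSet
  · rw [indicator_of_mem hx]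
    have hpos : 0 < min (x - i.1.1) (i.1.2 - x) :=
      lt_min (by linarith [hx.1]) (by linarith [hx.2])
    refine tendsto_const_nhds.congr' ?_
    filter_upwards [(tendsto_natCast_atTop_atTop.atTop_mul_const hpos).eventually_ge_atTop 1]
      with m hm
    rw [RatInterval.approx, min_eq_left hm, max_eq_right zero_le_one]
  · simp [i.approx_of_notMem _ hx, hx]

/-- Continuous approximations of `x ↦ exp (-stepFun n x)`. -/
noncomputable def expStepApprox (n : RatInterval →₀ ℕ) (m : ℕ) (x : ℝ) : ℝ :=
  Real.exp (-n.sum fun i c => c * i.approx m x)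

theorem continuous_expStepApprox (n : RatInterval →₀ ℕ) (m : ℕ) :
    Continuous (expStepApprox n m) := by
  have := fun i : RatInterval => i.continuous_approx m
  unfold expStepApprox Finsupp.sum
  fun_prop

theorem expStepApprox_mem_Icc (n : RatInterval →₀ ℕ) (m : ℕ) (x : ℝ) :
    expStepApprox n m x ∈ Icc (0 : ℝ) 1 := by
  refine ⟨(Real.exp_pos _).le, Real.exp_le_one_iff.2 (neg_nonpos.2 ?_)⟩
  exact Finset.sum_nonneg fun i _ => mul_nonneg (Nat.cast_nonneg _) (i.approx_nonneg m x)

theorem expStepApprox_eq_one {n : RatInterval →₀ ℕ} {a b : ℝ}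
    (hab : ∀ i ∈ n.support, i.toSet ⊆ Ioo a b) (m : ℕ) (x : ℝ) (hx : x ∉ Ioo a b) :
    expStepApprox n m x = 1 := by
  have : (n.sum fun i c => (c : ℝ) * i.approx m x) = 0 :=
    Finset.sum_eq_zero fun i hi => by
      simp only [i.approx_of_notMem m fun h => hx (hab i hi h), mul_zero]
  rw [expStepApprox, this, neg_zero, Real.exp_zero]

theorem tendsto_expStepApprox (n : RatInterval →₀ ℕ) (x : ℝ) :
    Tendsto (fun m => expStepApprox n m x) atTop (𝓝 (Real.exp (-(stepFun n x : ℝ)))) := by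
  have : (stepFun n x : ℝ) =
      ∑ i ∈ n.support, (n i : ℝ) * i.toSet.indicator (fun _ => 1) x := by
    simp only [stepFun, Finsupp.sum, Nat.cast_sum]
    refine Finset.sum_congr rfl fun i _ => ?_
    by_cases h : x ∈ i.toSet <;> simp [h]
  rw [this]
  exact (tendsto_finsetSum _ fun i _ => (i.tendsto_approx x).const_mul _).neg.rexp

section Functional

variable {Ω : Type*} [MeasurableSpace Ω] {P : Measure Ω} [IsProbabilityMeasure P] {k : ℝ}
  {T : Ω → Set ℝ}

/-- For a fixed configuration all the products run over one finite set of spacings, the same for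
every `m`, so the limit is taken factor by factor. -/
theorem ae_tendsto_spacingProd_expStepApprox (hk : 0 < k)
    (hT : IsPoissonProcess T (selfSimilarIntensity k) P) (n : RatInterval →₀ ℕ) :
    ∀ᵐ ω ∂P, Tendsto (fun m => spacingProd (expStepApprox n m) (T ω)) atTop
      (𝓝 (Real.exp (-(∫⁻ x, (stepFun n x : ℝ≥0∞) ∂spacingMeasure (T ω)).toReal))) := by
  obtain ⟨a, b, ha, hb, hab⟩ := exists_stepFun_eq_zero n
  filter_upwards [ae_isSparseConfiguration hk hT] with ω hω
  rw [hω.exp_neg_lintegral_spacingMeasure ha (measurable_stepFun n)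
      fun x hx => stepFun_eq_zero hab hx,
    hω.spacingProd_eq_prod ha (b := b) fun x hx => by simp [stepFun_eq_zero hab hx]]
  simp_rw [hω.spacingProd_eq_prod ha (expStepApprox_eq_one hab _)]
  exact tendsto_finsetProd _ fun s _ => tendsto_expStepApprox n _

theorem aemeasurable_exp_neg_lintegral_spacingMeasure (hk : 0 < k)
    (hT : IsPoissonProcess T (selfSimilarIntensity k) P) (n : RatInterval →₀ ℕ) :
    AEMeasurable (fun ω =>
      Real.exp (-(∫⁻ x, (stepFun n x : ℝ≥0∞) ∂spacingMeasure (T ω)).toReal)) P := by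
  obtain ⟨a, b, ha, hb, hab⟩ := exists_stepFun_eq_zero n
  exact aemeasurable_of_tendsto_metrizable_ae atTop (fun m => aemeasurable_spacingProd hk hT ha hb
    (continuous_expStepApprox n m) (expStepApprox_eq_one hab m))
    (ae_tendsto_spacingProd_expStepApprox hk hT n)

theorem spacingProd_mem_Icc {g : ℝ → ℝ} (hg01 : ∀ x, g x ∈ Icc (0 : ℝ) 1) (D : Set ℝ) :
    spacingProd g D ∈ Icc (0 : ℝ) 1 :=
  finprod_mem_induction (· ∈ Icc (0 : ℝ) 1) (by simp)
    (fun _ _ hx hy => ⟨mul_nonneg hx.1 hy.1, mul_le_one₀ hx.2 hy.1 hy.2⟩) fun _ _ => hg01 _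

/-- The spacings, counted with multiplicity, and the points of the process have the same Laplace
functional on step functions. -/
theorem integral_exp_neg_lintegral_spacingMeasure (hk : 0 < k)
    (hT : IsPoissonProcess T (selfSimilarIntensity k) P) (n : RatInterval →₀ ℕ) :
    ∫ ω, Real.exp (-(∫⁻ x, (stepFun n x : ℝ≥0∞) ∂spacingMeasure (T ω)).toReal) ∂P =
      ∫ ω, Real.exp (-(∫⁻ x, (stepFun n x : ℝ≥0∞) ∂pointMeasure (T ω)).toReal) ∂P := by
  obtain ⟨a, b, ha, hb, hab⟩ := exists_stepFun_eq_zero n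
  have hΛ : selfSimilarIntensity k (Ioo a b) ≠ ∞ :=
    selfSimilarIntensity_ne_top_of_subset hk ha Ioo_subset_Icc_self
  rw [hT.integral_exp_neg_lintegral (measurable_stepFun n) (stepFun_le n)]
  · have h1 : Tendsto (fun m => ∫ ω, spacingProd (expStepApprox n m) (T ω) ∂P) atTop
        (𝓝 (∫ ω, Real.exp (-(∫⁻ x, (stepFun n x : ℝ≥0∞) ∂spacingMeasure (T ω)).toReal) ∂P)) := by
      refine tendsto_integral_of_dominated_convergence (fun _ => 1)
        (fun m => (aemeasurable_spacingProd hk hT ha hb (continuous_expStepApprox n m)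
          (expStepApprox_eq_one hab m)).aestronglyMeasurable) (integrable_const 1)
        (fun m => Eventually.of_forall fun ω => ?_) (ae_tendsto_spacingProd_expStepApprox hk hT n)
      have := spacingProd_mem_Icc (expStepApprox_mem_Icc n m) (T ω)
      rw [Real.norm_of_nonneg this.1]
      exact this.2
    have h2 : Tendsto (fun m => ∫ x, (1 - expStepApprox n m x) ∂selfSimilarIntensity k) atTop
        (𝓝 (∫ x, (1 - Real.exp (-(stepFun n x : ℝ))) ∂selfSimilarIntensity k)) := by
      refine tendsto_integral_of_dominated_convergence ((Ioo a b).indicator fun _ => 1)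
        (fun m => ((continuous_const.sub
          (continuous_expStepApprox n m)).measurable).aestronglyMeasurable)
        ((integrable_indicator_iff measurableSet_Ioo).2 (integrableOn_const hΛ))
        (fun m => Eventually.of_forall fun x => ?_)
        (Eventually.of_forall fun x => (tendsto_expStepApprox n x).const_sub 1)
      by_cases hx : x ∈ Ioo a b
      · have := expStepApprox_mem_Icc n m x
        rw [indicator_of_mem hx, Real.norm_of_nonneg (sub_nonneg.2 this.2)]
        linarith [this.1]
      · simp [hx, expStepApprox_eq_one hab m x hx]
    refine tendsto_nhds_unique h1 (h2.neg.rexp.congr fun m => ?_)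
    exact (integral_spacingProd_of_continuous hk hT ha hb (continuous_expStepApprox n m)
      (expStepApprox_mem_Icc n m) (expStepApprox_eq_one hab m)).symm
  · refine ne_top_of_le_ne_top hΛ (measure_mono fun x hx => ?_)
    by_contra h
    exact hx (stepFun_eq_zero hab h)

end Functional

/-! ### From Laplace functionals to laws of random measures -/

/-- Measures on `(0, ∞)` which are finite on rational intervals bounded away from `0`. -/
structure IsLocallyFiniteOnPos (μ : Measure ℝ) : Prop where
  Iic_zero : μ (Iic 0) = 0
  lt_top : ∀ i : RatInterval, μ i.toSet < ∞

/-- The masses of the rational intervals under `μ`, rescaled to the unit interval by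
`x ↦ exp (-x)`. -/
noncomputable def expMasses (μ : Measure ℝ) (i : RatInterval) : unitInterval :=
  ⟨Real.exp (-(μ i.toSet).toReal), (Real.exp_pos _).le,
    Real.exp_le_one_iff.2 (neg_nonpos.2 ENNReal.toReal_nonneg)⟩

theorem IsLocallyFiniteOnPos.apply_toSet {μ : Measure ℝ} (hμ : IsLocallyFiniteOnPos μ)
    (i : RatInterval) : μ i.toSet = ENNReal.ofReal (-Real.log (expMasses μ i)) := by
  rw [expMasses, Real.log_exp, neg_neg, ENNReal.ofReal_toReal (hμ.lt_top i).ne]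

/-- A family of locally finite measures on `(0, ∞)` is measurable as soon as the masses of rational
intervals are. -/
theorem measurable_of_expMasses {α : Type*} [MeasurableSpace α] {X : α → Measure ℝ}
    (hX : ∀ x, IsLocallyFiniteOnPos (X x)) (hm : Measurable fun x => expMasses (X x)) :
    Measurable X := by
  have hI : ∀ i : RatInterval, Measurable fun x => X x i.toSet := fun i => by
    simp_rw [(hX _).apply_toSet i]
    have h1 := (measurable_pi_iff.1 hm i)
    have h2 : Measurable fun x => ((expMasses (X x) i : unitInterval) : ℝ) :=
      measurable_subtype_coe.comp h1
    fun_prop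
  let J : ℕ → RatInterval := fun n => ⟨(1 / ((n : ℚ) + 1), n), by positivity⟩
  have hJ : Monotone fun n => (J n).toSet := fun n m hnm => by
    refine Ioo_subset_Ioo ?_ ?_
    · simp only [J]
      push_cast
      gcongr
    · simp only [J]
      exact_mod_cast hnm
  have hJU : ⋃ n, (J n).toSet = Ioi 0 := by
    ext x
    simp only [mem_iUnion, mem_Ioi]
    constructor
    · rintro ⟨n, hn⟩
      exact (J n).fst_pos.trans hn.1
    · intro hx
      obtain ⟨n, hn⟩ := exists_nat_one_div_lt hx
      obtain ⟨m, hm⟩ := exists_nat_gt x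
      refine ⟨max n m, ?_, ?_⟩
      · refine lt_of_le_of_lt ?_ hn
        simp only [J]
        push_cast
        gcongr
        exact le_max_left _ _
      · refine hm.trans_le ?_
        simp only [J]
        exact_mod_cast le_max_right n m
  have hfin : ∀ n x, IsFiniteMeasure ((X x).restrict (J n).toSet) := fun n x =>
    ⟨by rw [Measure.restrict_apply_univ]; exact (hX x).lt_top _⟩
  have hres : ∀ n, Measurable fun x => (X x).restrict (J n).toSet := by
    intro n
    refine Measurable.measure_of_isPiSystem
      (BorelSpace.measurable_eq.trans Real.borel_eq_generateFrom_Ioo_rat)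
      Real.isPiSystem_Ioo_rat ?_ ?_
    · intro s hs
      simp only [mem_iUnion, mem_singleton_iff] at hs
      obtain ⟨p, q, _, rfl⟩ := hs
      simp_rw [Measure.restrict_apply measurableSet_Ioo]
      -- A `RatInterval` may be empty, so the family is stable under this intersection even when the
      -- intervals are disjoint.
      have : Ioo (p : ℝ) q ∩ (J n).toSet = RatInterval.toSet
          ⟨(max p (J n).1.1, min q (J n).1.2), lt_max_of_lt_right (J n).2⟩ := by
        simp only [RatInterval.toSet, Ioo_inter_Ioo, Rat.cast_max, Rat.cast_min]
      rw [this]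
      exact hI _
    · simp_rw [Measure.restrict_apply_univ]
      exact hI _
  refine Measure.measurable_of_measurable_coe _ fun A hA => ?_
  have : ∀ x, X x A = ⨆ n, (X x).restrict (J n).toSet A := fun x => by
    rw [← Measure.restrict_iUnion_apply_eq_iSup hJ.directed_le hA, hJU,
      Measure.restrict_eq_self_of_ae_mem]
    rw [ae_iff]
    convert! (hX x).Iic_zero using 2
    ext y
    simp
  simp_rw [this]
  exact Measurable.iSup fun n => (Measure.measurable_coe hA).comp (hres n)

/-- Locally finite measures are given the σ-algebra pulled back along `expMasses`. The inclusion
into all measures is measurable for it, so every event is already an event about the masses. -/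
theorem exists_measurableSet_expMasses {S : Set (Measure ℝ)} (hS : MeasurableSet S) :
    ∃ B : Set (RatInterval → unitInterval), MeasurableSet B ∧
      ∀ μ, IsLocallyFiniteOnPos μ → (μ ∈ S ↔ expMasses μ ∈ B) := by
  let m : MeasurableSpace {μ : Measure ℝ // IsLocallyFiniteOnPos μ} :=
    MeasurableSpace.comap (fun μ => expMasses μ.1) inferInstance
  have hval := @measurable_of_expMasses {μ : Measure ℝ // IsLocallyFiniteOnPos μ} m
    (fun μ => μ.1) (fun μ => μ.2) (comap_measurable _)
  obtain ⟨B, hB, hBS⟩ := hval hS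
  refine ⟨B, hB, fun μ hμ => ?_⟩
  have := congrArg (fun s => (⟨μ, hμ⟩ : {μ : Measure ℝ // IsLocallyFiniteOnPos μ}) ∈ s) hBS
  simp only [mem_preimage, eq_iff_iff] at this
  exact this.symm

section Transfer

variable {Ω : Type*} [MeasurableSpace Ω] {P : Measure Ω}

theorem aemeasurable_of_expMasses {X : Ω → Measure ℝ}
    (hX : ∀ᵐ ω ∂P, IsLocallyFiniteOnPos (X ω)) (hm : AEMeasurable (fun ω => expMasses (X ω)) P) :
    AEMeasurable X P := by
  classical
  obtain ⟨Y, hY, hXY⟩ := hm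
  have hae : ∀ᵐ ω ∂P, IsLocallyFiniteOnPos (X ω) ∧ expMasses (X ω) = Y ω := hX.and hXY
  -- On a measurable null set containing the bad points, `X` is replaced by the zero measure, which
  -- is locally finite.
  obtain ⟨s, hsub, hsm, hs0⟩ := exists_measurable_superset_of_null (ae_iff.1 hae)
  have hgood : ∀ ω ∉ s, IsLocallyFiniteOnPos (X ω) ∧ expMasses (X ω) = Y ω := fun ω hω => by
    by_contra h
    exact hω (hsub h)
  have hzero : IsLocallyFiniteOnPos 0 := ⟨by simp, by simp⟩
  refine ⟨fun ω => if ω ∈ s then 0 else X ω, measurable_of_expMasses (fun ω => ?_) ?_, ?_⟩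
  · split_ifs with h
    · exact hzero
    · exact (hgood ω h).1
  · have : (fun ω => expMasses (if ω ∈ s then 0 else X ω)) =
        fun ω => if ω ∈ s then expMasses 0 else Y ω := by
      ext1 ω
      split_ifs with h
      · rfl
      · exact (hgood ω h).2
    rw [this]
    exact Measurable.ite hsm measurable_const hY
  · have : ∀ᵐ ω ∂P, ω ∉ s := by simpa [ae_iff] using hs0
    filter_upwards [this] with ω hω
    rw [if_neg hω]

theorem identDistrib_of_expMasses {X Y : Ω → Measure ℝ}
    (hX : ∀ᵐ ω ∂P, IsLocallyFiniteOnPos (X ω)) (hY : ∀ᵐ ω ∂P, IsLocallyFiniteOnPos (Y ω))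
    (h : IdentDistrib (fun ω => expMasses (X ω)) (fun ω => expMasses (Y ω)) P P) :
    IdentDistrib X Y P P := by
  have hXm := aemeasurable_of_expMasses hX h.aemeasurable_fst
  have hYm := aemeasurable_of_expMasses hY h.aemeasurable_snd
  refine ⟨hXm, hYm, Measure.ext fun S hS => ?_⟩
  obtain ⟨B, hB, hBS⟩ := exists_measurableSet_expMasses hS
  rw [Measure.map_apply_of_aemeasurable hXm hS, Measure.map_apply_of_aemeasurable hYm hS]
  have e : ∀ Z : Ω → Measure ℝ, (∀ᵐ ω ∂P, IsLocallyFiniteOnPos (Z ω)) →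
      P (Z ⁻¹' S) = P ((fun ω => expMasses (Z ω)) ⁻¹' B) := fun Z hZ => by
    refine measure_congr ?_
    filter_upwards [hZ] with ω hω
    exact propext (hBS _ hω)
  rw [e X hX, e Y hY]
  exact h.measure_mem_eq hB

end Transfer

open BoundedContinuousFunction in
/-- A probability measure on a countable power of the unit interval is determined by its mixed
moments. -/
theorem ext_of_moments {ι : Type*} [Countable ι] {μ ν : Measure (ι → unitInterval)}
    [IsFiniteMeasure μ] [IsFiniteMeasure ν]
    (h : ∀ n : ι →₀ ℕ, ∫ y, (n.prod fun i m => (y i : ℝ) ^ m) ∂μ =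
      ∫ y, (n.prod fun i m => (y i : ℝ) ^ m) ∂ν) : μ = ν := by
  let coord : ι → ((ι → unitInterval) →ᵇ ℝ) := fun i =>
    BoundedContinuousFunction.mkOfCompact ⟨fun y => (y i : ℝ), by fun_prop⟩
  let A : StarSubalgebra ℝ ((ι → unitInterval) →ᵇ ℝ) :=
    { Algebra.adjoin ℝ (range coord) with
      star_mem' := fun {f} hf => by
        have : star f = f := by ext y; simp
        rwa [this] }
  -- The algebra generated by the coordinates separates points, and it is the linear span of the
  -- monomials.
  refine ext_of_forall_mem_subalgebra_integral_eq_of_polish (𝕜 := ℝ) (A := A) ?_ fun g hg => ?_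
  · intro x y hxy
    obtain ⟨i, hi⟩ := Function.ne_iff.1 hxy
    refine ⟨coord i, ⟨(coord i).toContinuousMap, ⟨coord i, Algebra.subset_adjoin ⟨i, rfl⟩, rfl⟩,
      rfl⟩, fun he => hi (Subtype.ext he)⟩
  · have hg' : g ∈ Submodule.span ℝ (Submonoid.closure (range coord) : Set _) := by
      rw [← Algebra.adjoin_eq_span]
      exact hg
    clear hg
    induction hg' using Submodule.span_induction with
    | mem f hf =>
      have hmon : ∃ n : ι →₀ ℕ, ∀ y, f y = n.prod fun i m => (y i : ℝ) ^ m := by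
        induction hf using Submonoid.closure_induction with
        | mem f hf =>
          obtain ⟨i, rfl⟩ := hf
          exact ⟨Finsupp.single i 1, fun y => by simp [coord]⟩
        | one => exact ⟨0, fun y => by simp⟩
        | mul f f' _ _ hf hf' =>
          obtain ⟨n, hn⟩ := hf
          obtain ⟨n', hn'⟩ := hf'
          classical
          refine ⟨n + n', fun y => ?_⟩
          rw [Finsupp.prod_add_index' (by simp) (fun i a b => pow_add _ a b),
            BoundedContinuousFunction.mul_apply, hn, hn']
      obtain ⟨n, hn⟩ := hmon
      simp_rw [hn]
      exact h n
    | zero => simp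
    | add f f' _ _ hf hf' =>
      simp only [BoundedContinuousFunction.add_apply]
      rw [integral_add (f.integrable _) (f'.integrable _),
        integral_add (f.integrable _) (f'.integrable _), hf, hf']
    | smul c f _ hf =>
      simp only [BoundedContinuousFunction.smul_apply]
      rw [integral_smul, integral_smul, hf]

theorem IsSparseConfiguration.isLocallyFiniteOnPos_spacingMeasure {D : Set ℝ}
    (hD : IsSparseConfiguration D) : IsLocallyFiniteOnPos (spacingMeasure D) :=
  ⟨hD.spacingMeasure_Iic_zero, fun i => hD.spacingMeasure_Ioo_lt_top i.fst_pos _⟩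

theorem IsSparseConfiguration.isLocallyFiniteOnPos_pointMeasure {D : Set ℝ}
    (hD : IsSparseConfiguration D) : IsLocallyFiniteOnPos (pointMeasure D) :=
  ⟨hD.pointMeasure_Iic_zero, fun i => hD.pointMeasure_Ioo_lt_top i.fst_pos _⟩

/-- This identifies mixed moments of `expMasses` with the Laplace functional at step functions. -/
theorem IsLocallyFiniteOnPos.prod_expMasses {μ : Measure ℝ} (hμ : IsLocallyFiniteOnPos μ)
    (n : RatInterval →₀ ℕ) : (n.prod fun i m => (expMasses μ i : ℝ) ^ m) =
      Real.exp (-(∫⁻ x, (stepFun n x : ℝ≥0∞) ∂μ).toReal) := by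
  rw [lintegral_stepFun, Finsupp.sum, ENNReal.toReal_sum fun i _ =>
    ENNReal.mul_ne_top (ENNReal.natCast_ne_top _) (hμ.lt_top i).ne, ← Finset.sum_neg_distrib,
    Real.exp_sum]
  refine Finset.prod_congr rfl fun i _ => ?_
  simp only [expMasses]
  rw [← Real.exp_nat_mul, ENNReal.toReal_mul, ENNReal.toReal_natCast, mul_neg]

theorem continuous_monomial {ι : Type*} (n : ι →₀ ℕ) :
    Continuous fun y : ι → unitInterval => n.prod fun i m => (y i : ℝ) ^ m :=
  continuous_finsetProd _ fun i _ => by fun_prop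

/-! ### Multiple points as a measurable event -/

/-- The measures on `ℝ` which, at every scale, give mass at least `2` to some rational interval
inside `[1 / (M + 1), M]`. -/
def hasMultipleBelow (M : ℕ) : Set (Measure ℝ) :=
  ⋂ n : ℕ, ⋃ i : {i : RatInterval // i.toSet ⊆ Icc (1 / ((M : ℝ) + 1)) M ∧
    (i.1.2 : ℝ) - i.1.1 < 1 / ((n : ℝ) + 1)}, {μ | 2 ≤ μ i.1.toSet}

theorem measurableSet_hasMultipleBelow (M : ℕ) : MeasurableSet (hasMultipleBelow M) :=
  MeasurableSet.iInter fun _ => MeasurableSet.iUnion fun i =>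
    Measure.measurable_coe i.1.measurableSet_toSet measurableSet_Ici

/-- The finitely many points of `D` in the compact window have a positive minimal gap if there are
at least two, and an interval shorter than it holds at most one. -/
theorem IsSparseConfiguration.pointMeasure_notMem_hasMultipleBelow {D : Set ℝ}
    (hD : IsSparseConfiguration D) (M : ℕ) : pointMeasure D ∉ hasMultipleBelow M := by
  set s := D ∩ Icc (1 / ((M : ℝ) + 1)) M
  have hs : s.Finite := hD.finite _ _ (by positivity)
  obtain ⟨n, hn⟩ : ∃ n : ℕ, s.Nontrivial → 1 / ((n : ℝ) + 1) < s.infsep := by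
    by_cases h : s.Nontrivial
    · obtain ⟨n, hn⟩ := exists_nat_one_div_lt (hs.infsep_pos_iff_nontrivial.2 h)
      exact ⟨n, fun _ => hn⟩
    · exact ⟨0, fun h' => absurd h' h⟩
  intro hmem
  obtain ⟨⟨i, hi1, hi2⟩, hi⟩ := mem_iUnion.1 (mem_iInter.1 hmem n)
  have hi' : 2 ≤ pointMeasure D i.toSet := hi
  have hsub : (D ∩ i.toSet).Subsingleton := by
    intro x hx y hy
    by_contra hxy
    have hxs : x ∈ s := ⟨hx.1, hi1 hx.2⟩
    have hys : y ∈ s := ⟨hy.1, hi1 hy.2⟩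
    have h1 := hn ⟨x, hxs, y, hys, hxy⟩
    have h2 := infsep_le_dist_of_mem hxs hys hxy
    have h3 : dist x y < i.1.2 - i.1.1 := by
      rw [Real.dist_eq, abs_lt]
      exact ⟨by linarith [hx.2.1, hy.2.2], by linarith [hx.2.2, hy.2.1]⟩
    linarith
  rw [pointMeasure_apply D i.measurableSet_toSet] at hi'
  rcases hsub.eq_empty_or_singleton with h | ⟨x, h⟩
  · rw [h] at hi'
    simp at hi'
  · rw [h, Measure.count_singleton] at hi'
    norm_num at hi'

theorem IsSparseConfiguration.injOn_spacing {D : Set ℝ} (hD : IsSparseConfiguration D)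
    (h : ∀ M, spacingMeasure D ∉ hasMultipleBelow M) :
    InjOn (fun s => s - lastBefore D s) D := by
  intro s hs t ht hst
  by_contra hne
  simp only at hst
  set d := s - lastBefore D s with hd
  have hd0 : 0 < d := sub_pos.2 (hD.lastBefore_lt (hD.pos s hs))
  obtain ⟨m, hm⟩ := exists_nat_one_div_lt hd0
  obtain ⟨m', hm'⟩ := exists_nat_gt d
  set M := max m m' with hM
  have h1 : 1 / ((M : ℝ) + 1) < d := by
    refine lt_of_le_of_lt ?_ hm
    gcongr
    exact le_max_left _ _
  have h2 : d < M := hm'.trans_le (by exact_mod_cast le_max_right m m')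
  refine h M (mem_iInter.2 fun n => mem_iUnion.2 ?_)
  -- Each end point is chosen within half of the allowed length from the repeated spacing `d`.
  have hε : 0 < 1 / (2 * ((n : ℝ) + 1)) := by positivity
  obtain ⟨p, hp1, hp2⟩ := exists_rat_btwn
    (show max (1 / ((M : ℝ) + 1)) (d - 1 / (2 * ((n : ℝ) + 1))) < d from
      max_lt h1 (by linarith))
  obtain ⟨q, hq1, hq2⟩ := exists_rat_btwn
    (show d < min (M : ℝ) (d + 1 / (2 * ((n : ℝ) + 1))) from lt_min h2 (by linarith))
  rw [max_lt_iff] at hp1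
  rw [lt_min_iff] at hq2
  have hp0 : (0 : ℝ) < p := lt_trans (by positivity) hp1.1
  refine ⟨⟨⟨(p, q), by exact_mod_cast hp0⟩, ?_, ?_⟩, ?_⟩
  · exact Ioo_subset_Icc_self.trans (Icc_subset_Icc hp1.1.le hq2.1.le)
  · have : 1 / ((n : ℝ) + 1) = 1 / (2 * ((n : ℝ) + 1)) + 1 / (2 * ((n : ℝ) + 1)) := by
      field_simp; norm_num
    rw [this]
    simp only
    linarith [hp1.2, hq2.2]
  · change 2 ≤ spacingMeasure D (Ioo (p : ℝ) q)
    rw [spacingMeasure_apply D measurableSet_Ioo]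
    have hsub : ({s, t} : Set ℝ) ⊆ {s ∈ D | s - lastBefore D s ∈ Ioo (p : ℝ) q} := by
      rintro u (rfl | rfl)
      · exact ⟨hs, hp2, hq1⟩
      · exact ⟨ht, hst ▸ ⟨hp2, hq1⟩⟩
    have := encard_le_encard hsub
    rw [encard_pair hne] at this
    exact_mod_cast this

/-! ### Equality of laws and distinctness of the spacings -/

section Law

variable {Ω : Type*} [MeasurableSpace Ω] {P : Measure Ω} [IsProbabilityMeasure P] {k : ℝ}
  {T : Ω → Set ℝ}

theorem identDistrib_spacingMeasure (hk : 0 < k)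
    (hT : IsPoissonProcess T (selfSimilarIntensity k) P) :
    IdentDistrib (fun ω => spacingMeasure (T ω)) (fun ω => pointMeasure (T ω)) P P := by
  have hD := ae_isSparseConfiguration hk hT
  have hS := hD.mono fun ω hω => hω.isLocallyFiniteOnPos_spacingMeasure
  have hN := hD.mono fun ω hω => hω.isLocallyFiniteOnPos_pointMeasure
  refine identDistrib_of_expMasses hS hN ?_
  have hSm : AEMeasurable (fun ω => expMasses (spacingMeasure (T ω))) P := by
    refine aemeasurable_pi_iff.2 fun i => ?_
    have h1 : AEMeasurable (fun ω => (expMasses (spacingMeasure (T ω)) i : ℝ)) P := by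
      refine (aemeasurable_exp_neg_lintegral_spacingMeasure hk hT (Finsupp.single i 1)).congr ?_
      filter_upwards [hS] with ω hω
      rw [← hω.prod_expMasses]
      simp
    exact h1.subtype_mk
  have hNm : AEMeasurable (fun ω => expMasses (pointMeasure (T ω))) P := by
    refine aemeasurable_pi_iff.2 fun i => AEMeasurable.subtype_mk ?_
    have := hT.measurable_apply i.measurableSet_toSet
    exact (by fun_prop : Measurable fun ω =>
      Real.exp (-(pointMeasure (T ω) i.toSet).toReal)).aemeasurable
  refine ⟨hSm, hNm, ?_⟩
  have := Measure.isProbabilityMeasure_map hSm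
  have := Measure.isProbabilityMeasure_map hNm
  refine ext_of_moments fun n => ?_
  rw [integral_map hSm (continuous_monomial n).aestronglyMeasurable,
    integral_map hNm (continuous_monomial n).aestronglyMeasurable,
    integral_congr_ae (hS.mono fun ω hω => hω.prod_expMasses n),
    integral_congr_ae (hN.mono fun ω hω => hω.prod_expMasses n)]
  exact integral_exp_neg_lintegral_spacingMeasure hk hT n

/-- No joint law of two spacings is computed: the point process is almost surely simple, and the
equality in law carries this over to the spacings. -/
theorem ae_injOn_spacing (hk : 0 < k) (hT : IsPoissonProcess T (selfSimilarIntensity k) P) :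
    ∀ᵐ ω ∂P, InjOn (fun s => s - lastBefore (T ω) s) (T ω) := by
  have h1 : ∀ᵐ ω ∂P, ∀ M, spacingMeasure (T ω) ∉ hasMultipleBelow M := by
    refine ae_all_iff.2 fun M => ?_
    have h2 : ∀ᵐ ω ∂P, pointMeasure (T ω) ∉ hasMultipleBelow M :=
      (ae_isSparseConfiguration hk hT).mono fun ω hω => hω.pointMeasure_notMem_hasMultipleBelow M
    exact (identDistrib_spacingMeasure hk hT).symm.ae_snd
      (measurableSet_hasMultipleBelow M).compl h2
  filter_upwards [h1, ae_isSparseConfiguration hk hT] with ω h1 hω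
  exact hω.injOn_spacing h1

end Law

theorem mainTheorem2 {Ω : Type*} [MeasurableSpace Ω] (P : Measure Ω) [IsProbabilityMeasure P]
    (k : ℝ) (hk : 0 < k) (T : Ω → Set ℝ)
    (hT : IsPoissonProcess T (selfSimilarIntensity k) P) :
    (∀ᵐ ω ∂P, ∀ s t s' t' : ℝ, IsConsecutive (T ω) s t → IsConsecutive (T ω) s' t' →
      t - s = t' - s' → s = s' ∧ t = t') ∧
    IdentDistrib (fun ω => pointMeasure (spacings (T ω))) (fun ω => pointMeasure (T ω)) P P := by
  have hD := ae_isSparseConfiguration hk hT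
  have hinj := ae_injOn_spacing hk hT
  constructor
  · filter_upwards [hD, hinj] with ω hω hi s t s' t' hst hst' h
    rw [hω.isConsecutive_iff] at hst hst'
    obtain ⟨ht, rfl⟩ := hst
    obtain ⟨ht', rfl⟩ := hst'
    obtain rfl := hi ht ht' h
    exact ⟨rfl, rfl⟩
  · have hae : (fun ω => spacingMeasure (T ω)) =ᵐ[P] fun ω => pointMeasure (spacings (T ω)) := by
      filter_upwards [hD, hinj] with ω hω hi
      exact (hω.pointMeasure_spacings hi).symm
    have h := identDistrib_spacingMeasure hk hT
    exact ⟨h.aemeasurable_fst.congr hae, h.aemeasurable_snd,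
      (Measure.map_congr hae).symm.trans h.map_eq⟩
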